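/- Let $d\ge 1$, let $\Sigma\in\mathbb{R}^{d\times d}$ be symmetric positive definite, $D=\Sigma^{-1}$, $|x|_D^2=\langle x,Dx\rangle$, and $L=\{1,\dots,d\}$. Let $\theta\in\mathbb{R}^d$ have all components negative, and let $R\in\mathbb{R}^{d\times d}$ be a nonsingular $\mathcal M$-matrix, i.e. $R=\mu\mathbb{I}_d-A$ with $A$ entrywise nonnegative and $\mu$ greater than the spectral radius of $A$. Let $T$ be a norm on $\mathbb{R}^d$ such that $T(v)\le T(w)$ whenever $v,w\in\mathbb{R}^d_+$ and $v\le w$ componentwise. A pair $(\phi,\eta)$ of continuous functions $[0,\infty)\to\mathbb{R}^d_+$ solves the Skorokhod problem for a continuous $\psi:[0,\infty)\to\mathbb{R}^d$ with $\psi(0)\in\mathbb{R}^d_+$ if $\phi(t)=\psi(t)+R\eta(t)$ for all $t\ge 0$ and, for each $i$, $\eta_i(0)=0$, $\eta_i$ is nondecreasing and $\int_0^\infty\phi_i\,d\eta_i=0$. For $w,v\in\mathbb{R}^d_+$ let $$\mathcal{I}(w,v)=\inf \frac12\int_0^{\tau_\phi(v)}|\dot\psi(t)-\theta|_D^2\,dt\in[0,\infty],\qquad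 \tau_\phi(v)=\inf\{t\ge0:\phi(t)=v\},$$ where the infimum is over all (locally) absolutely continuous $\psi:[0,\infty)\to\mathbb{R}^d$ with $\psi(0)=w$ and all solutions $(\phi,\eta)$ of the Skorokhod problem for $\psi$ with $\tau_\phi(v)<\infty$ (and $\inf\emptyset=\infty$). For $K\subseteq L$ let $F_K=\{x\in\mathbb{R}^d_+: x_i=0\ (i\in K),\ x_j>0\ (j\in L\setminus K)\}$. Call $w,v\in\mathbb{R}^d_+$ compatible with $K$ if $w\ne v$, $w_i=v_i=0$ for $i\in K$, and $w_j\neq0$ or $v_j\neq0$ for each $j\notin K$. For such $w,v$ let $\mathcal{I}^*_K(w,v)$ be the infimum defined as $\mathcal{I}(w,v)$, with the additional constraint that $\phi(t)\in F_K$ for all $t\in(0,\tau_\phi(v))$. Then: 1. $\mathcal{I}^*_K(w,v)$ depends only on $K$ and $v-w$; denote it by $\mathcal{I}^*_K(v-w)$. 2. For $K\subsetneq L$ (including $K=\emptyset$) let $\mathbb{D}_K$ be the set of $u\in\mathbb{R}^d$ with $u_i=0$ for $i\in K$, $\sum_{i=1}^d|u_i|=1$, and $u_j\ge0$ for some $j\in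 L\setminus K$. Then $0<\mathcal{I}^*_K(u)<\infty$ for all $u\in\mathbb{D}_K$, and the maximum $$\mathbf r=\max\left\{\frac{T(u)}{\mathcal{I}^*_K(u)}: K\subsetneq L,\ u\in\mathbb{D}_K\right\}$$ exists and is positive. 3. Let $B=\{x\in\mathbb{R}^d_+:\sum_{i=1}^d x_i\ge1\}$ and $$\bar T(v)=-\frac{T(v)}{\mathbf r}+\inf_{x\in B}\frac{T(x)}{\mathbf r},\qquad v\in\mathbb{R}^d_+.$$ Then $\bar T$ is a subsolution of the variational problem, that is: (i) $\bar T$ is continuous on $\mathbb{R}^d_+$; (ii) $\bar T(x)\le0$ for all $x\in B$; (iii) $\bar T(w)-\bar T(v)\le\mathcal{I}(w,v)$ for all $w,v\in\mathbb{R}^d_+\setminus(\{0\}\cup B)$. -/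

import Mathlib

open Set MeasureTheory
open scoped ENNReal Matrix

noncomputable section

namespace SRBM

variable {d : ℕ}

/-- The nonnegative orthant `ℝ^d_+`. -/
def orthant (d : ℕ) : Set (Fin d → ℝ) := {x | ∀ i, 0 ≤ x i}

/-- The target set `B`: points of the orthant whose coordinates add up to at least one. -/
def targetSet (d : ℕ) : Set (Fin d → ℝ) := {x | x ∈ orthant d ∧ 1 ≤ ∑ i, x i}

/-- The face `F_K` of the orthant: the coordinates in `K` vanish, the others are positive. -/
def face (K : Finset (Fin d)) : Set (Fin d → ℝ) :=
  {x | (∀ i ∈ K, x i = 0) ∧ ∀ j, j ∉ K → 0 < x j}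

/-- Nonsingular M-matrix: `R = μ I - A` with `A` entrywise nonnegative and `μ` greater than the
spectral radius of `A` (computed over the complex numbers). -/
def IsNonsingularMMatrix (R : Matrix (Fin d) (Fin d) ℝ) : Prop :=
  ∃ (μ : ℝ) (A : Matrix (Fin d) (Fin d) ℝ),
    (∀ i j, 0 ≤ A i j) ∧
    spectralRadius ℂ (A.map (algebraMap ℝ ℂ)) < ENNReal.ofReal μ ∧
    R = μ • (1 : Matrix (Fin d) (Fin d) ℝ) - A

/-- A continuous nondecreasing function on `[0,∞)`, extended by its value at `0` to the negative
half-line, as a Stieltjes function. -/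
def stieltjesOfIci (f : ℝ → ℝ) (hm : MonotoneOn f (Ici 0)) (hc : ContinuousOn f (Ici 0)) :
    StieltjesFunction ℝ where
  toFun t := f (max t 0)
  mono' := fun s t hst => hm (le_max_right s 0) (le_max_right t 0) (max_le_max_right 0 hst)
  right_continuous' := fun x =>
    (hc.comp_continuous (continuous_id.max continuous_const)
      (fun t => le_max_right t 0)).continuousWithinAt

/-- `(φ, η)` solves the Skorokhod problem for `ψ` associated with the reflection matrix `R`.
Paths are functions of a real variable of which only the values on `[0,∞)` matter. -/
structure IsSkorokhodSolution (R : Matrix (Fin d) (Fin d) ℝ) (ψ φ η : ℝ → Fin d → ℝ) : Prop where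
  cont_ψ : ContinuousOn ψ (Ici 0)
  init_ψ : ψ 0 ∈ orthant d
  cont_φ : ContinuousOn φ (Ici 0)
  cont_η : ∀ i, ContinuousOn (fun t => η t i) (Ici 0)
  eq : ∀ t, 0 ≤ t → φ t = ψ t + R *ᵥ η t
  nonneg : ∀ t, 0 ≤ t → φ t ∈ orthant d
  η_zero : ∀ i, η 0 i = 0
  η_mono : ∀ i, MonotoneOn (fun t => η t i) (Ici 0)
  /-- `∫_0^∞ φ_i dη_i = 0`, as a Lebesgue–Stieltjes integral of a nonnegative function. -/
  compl : ∀ i, ∫⁻ t in Ici (0 : ℝ), ENNReal.ofReal (φ t i)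
    ∂(stieltjesOfIci (fun t => η t i) (η_mono i) (cont_η i)).measure = 0

/-- `ψ ∈ AC_w([0,∞); ℝ^d)`: absolutely continuous on every compact interval `[0,t]`, started
at `w`. -/
def IsACFrom (w : Fin d → ℝ) (ψ : ℝ → Fin d → ℝ) : Prop :=
  (∀ t, 0 ≤ t → AbsolutelyContinuousOnInterval ψ 0 t) ∧ ψ 0 = w

/-- The cost `(1/2) ∫_0^τ |ψ'(t) - θ|_D^2 dt` with `D = Σ⁻¹`, possibly infinite. -/
def pathCost (θ : Fin d → ℝ) (Sig : Matrix (Fin d) (Fin d) ℝ) (ψ : ℝ → Fin d → ℝ) (τ : ℝ) :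
    ℝ≥0∞ :=
  ∫⁻ t in Ioc 0 τ, ENNReal.ofReal (1 / 2 * ((deriv ψ t - θ) ⬝ᵥ (Sig⁻¹ *ᵥ (deriv ψ t - θ))))

/-- `τ` is the (finite) first time at which `φ` is at `v`. -/
def IsFirstHit (φ : ℝ → Fin d → ℝ) (v : Fin d → ℝ) (τ : ℝ) : Prop :=
  IsLeast {t : ℝ | 0 ≤ t ∧ φ t = v} τ

/-- The globally optimal cost `I(w,v)`. -/
def globalCost (θ : Fin d → ℝ) (Sig R : Matrix (Fin d) (Fin d) ℝ) (w v : Fin d → ℝ) : ℝ≥0∞ :=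
  sInf {c | ∃ (ψ φ η : ℝ → Fin d → ℝ) (τ : ℝ), IsACFrom w ψ ∧ IsSkorokhodSolution R ψ φ η ∧
    IsFirstHit φ v τ ∧ c = pathCost θ Sig ψ τ}

/-- The locally optimal cost `I*_K(w,v)`, where the reflected path has to stay in the face `F_K`
strictly between its start and the first time it hits `v`. -/
def localCost (θ : Fin d → ℝ) (Sig R : Matrix (Fin d) (Fin d) ℝ) (K : Finset (Fin d))
    (w v : Fin d → ℝ) : ℝ≥0∞ :=
  sInf {c | ∃ (ψ φ η : ℝ → Fin d → ℝ) (τ : ℝ), IsACFrom w ψ ∧ IsSkorokhodSolution R ψ φ η ∧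
    IsFirstHit φ v τ ∧ (∀ t ∈ Ioo 0 τ, φ t ∈ face K) ∧ c = pathCost θ Sig ψ τ}

/-- The condition on the endpoints `w`, `v` under which the local cost along `F_K` is considered. -/
structure Compatible (K : Finset (Fin d)) (w v : Fin d → ℝ) : Prop where
  w_mem : w ∈ orthant d
  v_mem : v ∈ orthant d
  ne : w ≠ v
  zero : ∀ i ∈ K, w i = 0 ∧ v i = 0
  pos : ∀ j, j ∉ K → w j ≠ 0 ∨ v j ≠ 0

/-- The local cost `I*_K(u)` of a displacement `u`: the value `I*_K(w,v)` for compatible endpoints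
with `v - w = u`. The value is the same for all such pairs, which is part of the main theorem; the
infimum only serves to select it. -/
def dirCost (θ : Fin d → ℝ) (Sig R : Matrix (Fin d) (Fin d) ℝ) (K : Finset (Fin d))
    (u : Fin d → ℝ) : ℝ≥0∞ :=
  sInf {c | ∃ w v : Fin d → ℝ, Compatible K w v ∧ v - w = u ∧ c = localCost θ Sig R K w v}

/-- The direction set `D_K`. -/
def dirSet (K : Finset (Fin d)) : Set (Fin d → ℝ) :=
  {u | (∀ i ∈ K, u i = 0) ∧ ∑ i, |u i| = 1 ∧ ∃ j, j ∉ K ∧ 0 ≤ u j}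

/-- The set of all ratios `T(u) / I*_K(u)` with `K` a proper subset of the index set and
`u ∈ D_K`. -/
def ratioSet (θ : Fin d → ℝ) (Sig R : Matrix (Fin d) (Fin d) ℝ) (T : (Fin d → ℝ) → ℝ) : Set ℝ :=
  {ρ | ∃ (K : Finset (Fin d)) (u : Fin d → ℝ), K ⊂ Finset.univ ∧ u ∈ dirSet K ∧
    ρ = T u / (dirCost θ Sig R K u).toReal}

/-- The scaling constant `r`. -/
def scale (θ : Fin d → ℝ) (Sig R : Matrix (Fin d) (Fin d) ℝ) (T : (Fin d → ℝ) → ℝ) : ℝ :=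
  sSup (ratioSet θ Sig R T)

/-- The function `T̄(v) = -T(v)/r + inf_{x ∈ B} T(x)/r`. -/
def Tbar (θ : Fin d → ℝ) (Sig R : Matrix (Fin d) (Fin d) ℝ) (T : (Fin d → ℝ) → ℝ)
    (v : Fin d → ℝ) : ℝ :=
  -(T v / scale θ Sig R T) + sInf ((fun x => T x / scale θ Sig R T) '' targetSet d)

/-- Subsolutions of the variational problem. -/
structure IsSubsolution (θ : Fin d → ℝ) (Sig R : Matrix (Fin d) (Fin d) ℝ)
    (U : (Fin d → ℝ) → ℝ) : Prop where
  cont : ContinuousOn U (orthant d)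
  nonpos : ∀ x ∈ targetSet d, U x ≤ 0
  le_cost : ∀ w ∈ orthant d \ ({0} ∪ targetSet d), ∀ v ∈ orthant d \ ({0} ∪ targetSet d),
    ((U w - U v : ℝ) : EReal) ≤ (globalCost θ Sig R w v : EReal)

end SRBM

end

noncomputable section

namespace SRBM

open Filter Topology

/-! Both path problems are reduced to finite dimensions. If the reflected path stays in `F_K`, only
the regulators indexed by `K` can grow, so the mean velocity of `ψ` is that of the displacement
minus `R p`, where `p` is the mean pushing rate. By Jensen (`ofReal_mean_le_pathCost`) the path
costs at least as much as the corresponding straight line, and compatibility makes such lines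
admissible. Hence the local cost is a minimisation over a duration and a pushing rate that involves
only `v - w` (`localCost_eq_faceCost`).

Optimising the duration leaves the Cauchy–Schwarz defect between `u` and the drift `q = R p + θ`
(`gap`). It vanishes only if `q` is a nonnegative multiple of `u`; the M-matrix property makes `q`
negative off `K`, whereas `u` has a nonnegative coordinate there. The same property makes the defect
grow linearly in `p`, so compactness yields a positive minimum of cost over `T` on each face, and
there are finitely many faces.

For the subsolution bound, an oscillation inequality makes `η` and `φ` absolutely continuous. At
almost every time, with `K` the zero set of `φ t`, either the velocity has a nonnegative coordinate
off `K` and the definition of `r` bounds the growth of `T`, or all coordinates are nonincreasing and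
monotonicity of `T` suffices (`IsSkorokhodSolution.deriv_seminorm_le`). Integrating compares the
endpoints. -/

/-- The quadratic form of a positive definite matrix is the squared Euclidean norm of an injective
linear image. -/
theorem exists_quadraticForm_eq_norm_sq {d : ℕ} {Sig : Matrix (Fin d) (Fin d) ℝ}
    (hSig : Sig.PosDef) :
    ∃ E : (Fin d → ℝ) →ₗ[ℝ] EuclideanSpace ℝ (Fin d), Function.Injective E ∧
      ∀ x, x ⬝ᵥ (Sig⁻¹ *ᵥ x) = ‖E x‖ ^ 2 := by
  have hD : (Sig⁻¹).PosDef := hSig.inv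
  have hex : ∃ M : Matrix (Fin d) (Fin d) ℝ, Sig⁻¹ = Mᵀ * M := by
    open scoped MatrixOrder in
    obtain ⟨M, hM⟩ := CStarAlgebra.nonneg_iff_eq_star_mul_self.mp hD.posSemidef.nonneg
    exact ⟨M, by rw [hM, Matrix.star_eq_conjTranspose, Matrix.conjTranspose_eq_transpose_of_trivial]⟩
  obtain ⟨M, hM⟩ := hex
  let E : (Fin d → ℝ) →ₗ[ℝ] EuclideanSpace ℝ (Fin d) :=
    (WithLp.linearEquiv 2 ℝ (Fin d → ℝ)).symm.toLinearMap ∘ₗ M.mulVecLin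
  have hE : ∀ x, x ⬝ᵥ (Sig⁻¹ *ᵥ x) = ‖E x‖ ^ 2 := by
    intro x
    rw [EuclideanSpace.norm_sq_eq, hM, ← Matrix.mulVec_mulVec, Matrix.dotProduct_mulVec,
      Matrix.vecMul_transpose]
    simp [E, dotProduct, sq]
  refine ⟨E, (injective_iff_map_eq_zero E).2 fun x hx => ?_, hE⟩
  by_contra hne
  have := hD.dotProduct_mulVec_pos hne
  simp only [star_trivial] at this
  rw [hE, hx] at this
  simp at this

/-! ### Nonsingular M-matrices -/

/-- A nonnegative matrix with a nonzero nonnegative vector satisfying `μ y ≤ A y` has spectral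
radius at least `μ`. -/
theorem ofReal_le_spectralRadius {d : ℕ} {A : Matrix (Fin d) (Fin d) ℝ} {μ : ℝ}
    (hA : ∀ i j, 0 ≤ A i j) {y : Fin d → ℝ} (hy : ∀ i, 0 ≤ y i) (hy0 : y ≠ 0)
    (h : ∀ i, μ * y i ≤ (A *ᵥ y) i) :
    ENNReal.ofReal μ ≤ spectralRadius ℂ (A.map (algebraMap ℝ ℂ)) := by
  let _ : NormedRing (Matrix (Fin d) (Fin d) ℂ) := Matrix.linftyOpNormedRing
  let _ : NormedAlgebra ℂ (Matrix (Fin d) (Fin d) ℂ) := Matrix.linftyOpNormedAlgebra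
  have : CompleteSpace (Matrix (Fin d) (Fin d) ℂ) := FiniteDimensional.complete ℂ _
  by_contra hlt
  rw [not_le] at hlt
  have hμ : 0 < μ := by
    rw [← ENNReal.ofReal_pos]; exact lt_of_le_of_lt zero_le hlt
  obtain ⟨s, hs1, hs2⟩ := ENNReal.lt_iff_exists_nnreal_btwn.1 hlt
  have hsμ : (s : ℝ) < μ := by
    rw [← ENNReal.ofReal_coe_nnreal, ENNReal.ofReal_lt_ofReal_iff hμ] at hs2
    exact hs2
  -- Gelfand's formula bounds the norm of `A ^ n` by `s ^ n` with `s < μ` for large `n`, while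
  -- iterating the hypothesis forces growth like `μ ^ n`.
  have hgel := spectrum.pow_nnnorm_pow_one_div_tendsto_nhds_spectralRadius
    (A.map (algebraMap ℝ ℂ))
  have hpow : ∀ n : ℕ, ∀ i, μ ^ n * y i ≤ ((A ^ n) *ᵥ y) i := by
    intro n
    induction n with
    | zero => intro i; simp
    | succ n ih =>
      intro i
      rw [pow_succ' A, ← Matrix.mulVec_mulVec]
      calc μ ^ (n + 1) * y i = μ ^ n * (μ * y i) := by ring
        _ ≤ μ ^ n * (A *ᵥ y) i := by gcongr; exact h i
        _ = ∑ j, A i j * (μ ^ n * y j) := by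
          simp only [Matrix.mulVec, dotProduct, Finset.mul_sum]
          exact Finset.sum_congr rfl fun j _ => by ring
        _ ≤ ∑ j, A i j * ((A ^ n) *ᵥ y) j :=
          Finset.sum_le_sum fun j _ => mul_le_mul_of_nonneg_left (ih j) (hA i j)
        _ = (A *ᵥ ((A ^ n) *ᵥ y)) i := rfl
  obtain ⟨i, hi⟩ := Function.ne_iff.1 hy0
  have hi : 0 < y i := lt_of_le_of_ne (hy i) (Ne.symm hi)
  have hnorm : ∀ n : ℕ, μ ^ n * y i ≤ ‖(A.map (algebraMap ℝ ℂ)) ^ n‖ * ‖y‖ := by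
    intro n
    have h1 : (((A ^ n) *ᵥ y) i : ℂ) =
        ((A.map (algebraMap ℝ ℂ)) ^ n *ᵥ (fun j => (y j : ℂ))) i := by
      have : (A.map (algebraMap ℝ ℂ)) ^ n = (A ^ n).map (algebraMap ℝ ℂ) :=
        (map_pow (algebraMap ℝ ℂ).mapMatrix A n).symm
      rw [this]
      simp [Matrix.mulVec, dotProduct]
    have h2 : ‖(fun j => (y j : ℂ))‖ ≤ ‖y‖ := by
      refine (pi_norm_le_iff_of_nonneg (norm_nonneg _)).2 fun j => ?_
      simpa using norm_le_pi_norm y j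
    calc μ ^ n * y i ≤ ((A ^ n) *ᵥ y) i := hpow n i
      _ ≤ ‖(((A ^ n) *ᵥ y) i : ℂ)‖ := by
        rw [Complex.norm_real]; exact le_abs_self _
      _ ≤ ‖(A.map (algebraMap ℝ ℂ)) ^ n *ᵥ (fun j => (y j : ℂ))‖ := by
        rw [h1]; exact norm_le_pi_norm _ i
      _ ≤ ‖(A.map (algebraMap ℝ ℂ)) ^ n‖ * ‖(fun j => (y j : ℂ))‖ :=
        Matrix.linfty_opNorm_mulVec _ _
      _ ≤ _ := by gcongr
  have hynorm : 0 < ‖y‖ := norm_pos_iff.2 hy0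
  have hev : ∀ᶠ n : ℕ in atTop, y i / ‖y‖ ≤ ((s : ℝ) / μ) ^ n := by
    filter_upwards [hgel.eventually_lt_const hs1, eventually_gt_atTop 0] with n hn hn0
    have hn1 : (‖(A.map (algebraMap ℝ ℂ)) ^ n‖₊ : ℝ≥0∞) < (s : ℝ≥0∞) ^ n := by
      have := ENNReal.rpow_lt_rpow hn (z := n) (by exact_mod_cast hn0)
      rw [← ENNReal.rpow_mul, one_div_mul_cancel (by positivity), ENNReal.rpow_one,
        ENNReal.rpow_natCast] at this
      exact this
    have hn2 : ‖(A.map (algebraMap ℝ ℂ)) ^ n‖ ≤ (s : ℝ) ^ n := by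
      exact_mod_cast hn1.le
    rw [div_pow, div_le_div_iff₀ hynorm (by positivity)]
    calc y i * μ ^ n = μ ^ n * y i := mul_comm _ _
      _ ≤ _ := hnorm n
      _ ≤ _ := by gcongr
  have hlim : Tendsto (fun n : ℕ => ((s : ℝ) / μ) ^ n) atTop (𝓝 0) :=
    tendsto_pow_atTop_nhds_zero_of_lt_one (by positivity) ((div_lt_one hμ).2 hsμ)
  have := ge_of_tendsto hlim hev
  have : 0 < y i / ‖y‖ := by positivity
  linarith

/-- A nonnegative vector whose image under a nonsingular M-matrix is nonpositive vanishes. -/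
theorem IsNonsingularMMatrix.eq_zero {d : ℕ} {R : Matrix (Fin d) (Fin d) ℝ}
    (hR : IsNonsingularMMatrix R) {y : Fin d → ℝ} (hy : ∀ i, 0 ≤ y i)
    (h : ∀ i, (R *ᵥ y) i ≤ 0) : y = 0 := by
  obtain ⟨μ, A, hA, hρ, rfl⟩ := hR
  by_contra hy0
  refine absurd (ofReal_le_spectralRadius hA hy hy0 (μ := μ) fun i => ?_) (not_le.2 hρ)
  have := h i
  simp only [Matrix.sub_mulVec, Matrix.smul_mulVec, Matrix.one_mulVec, Pi.sub_apply,
    Pi.smul_apply, smul_eq_mul] at this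
  linarith

theorem IsNonsingularMMatrix.offDiag_nonpos {d : ℕ} {R : Matrix (Fin d) (Fin d) ℝ}
    (hR : IsNonsingularMMatrix R) {i j : Fin d} (hij : i ≠ j) : R i j ≤ 0 := by
  obtain ⟨μ, A, hA, -, rfl⟩ := hR
  simp [Matrix.one_apply_ne hij, hA i j]

/-- A nonnegative vector is controlled by the largest coordinate of its image under a nonsingular
M-matrix. -/
theorem IsNonsingularMMatrix.exists_bound {d : ℕ} {R : Matrix (Fin d) (Fin d) ℝ}
    (hR : IsNonsingularMMatrix R) :
    ∃ C : ℝ, 0 ≤ C ∧ ∀ (y : Fin d → ℝ) (V : ℝ), (∀ i, 0 ≤ y i) → 0 ≤ V →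
      (∀ i, (R *ᵥ y) i ≤ V) → ‖y‖ ≤ C * V := by
  by_contra hcon
  push Not at hcon
  -- Normalised counterexamples accumulate at a nonnegative unit vector with nonpositive image,
  -- which `IsNonsingularMMatrix.eq_zero` excludes.
  have hn : ∀ n : ℕ, ∃ z : Fin d → ℝ, (∀ i, 0 ≤ z i) ∧ ‖z‖ = 1 ∧
      ∀ i, (R *ᵥ z) i ≤ 1 / ((n : ℝ) + 1) := by
    intro n
    obtain ⟨y, V, hy, hV, hRy, hlt⟩ := hcon (n + 1) (by positivity)
    have hpos : 0 < ‖y‖ := lt_of_le_of_lt (by positivity) hlt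
    refine ⟨‖y‖⁻¹ • y, fun i => mul_nonneg (by positivity) (hy i), ?_, fun i => ?_⟩
    · rw [norm_smul, norm_inv, norm_norm, inv_mul_cancel₀ hpos.ne']
    · rw [Matrix.mulVec_smul, Pi.smul_apply, smul_eq_mul, inv_mul_le_iff₀ hpos]
      refine (hRy i).trans ?_
      rw [mul_one_div, le_div_iff₀ (by positivity)]
      linarith
  choose z hz0 hz1 hzR using hn
  obtain ⟨a, ha, φ, hφ, hlim⟩ := (isCompact_sphere (0 : Fin d → ℝ) 1).tendsto_subseq
    (x := z) (fun n => by simp [hz1 n])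
  have ha0 : a = 0 := by
    refine hR.eq_zero (fun i => ?_) fun i => ?_
    · exact ge_of_tendsto' ((continuous_apply i).continuousAt.tendsto.comp hlim)
        fun n => hz0 _ i
    · have h1 : Tendsto (fun n => (R *ᵥ z (φ n)) i) atTop (𝓝 ((R *ᵥ a) i)) := by
        have hc : Continuous fun x : Fin d → ℝ => (R *ᵥ x) i := by fun_prop
        exact hc.continuousAt.tendsto.comp hlim
      have h2 : Tendsto (fun n => 1 / (((φ n : ℕ) : ℝ) + 1)) atTop (𝓝 0) :=
        tendsto_one_div_add_atTop_nhds_zero_nat.comp hφ.tendsto_atTop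
      exact le_of_tendsto_of_tendsto' h1 h2 fun n => hzR _ i
  rw [ha0] at ha
  simp at ha

/-! ### Absolute continuity of the regulator and of the reflected path -/

section

/-- A function whose increment over `[s, t]` is dominated by an increment over some `[s, r]`,
`r ∈ [s, t]`, of an absolutely continuous function is absolutely continuous. -/
theorem absolutelyContinuousOnInterval_of_dist_le {X Y : Type*} [PseudoMetricSpace X]
    [PseudoMetricSpace Y] {f : ℝ → X} {g : ℝ → Y} {a b C : ℝ} (hC : 0 ≤ C)
    (hf : AbsolutelyContinuousOnInterval f a b)
    (h : ∀ s ∈ uIcc a b, ∀ t ∈ uIcc a b, s ≤ t →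
      ∃ r ∈ Icc s t, dist (g s) (g t) ≤ C * dist (f s) (f r)) :
    AbsolutelyContinuousOnInterval g a b := by
  rw [absolutelyContinuousOnInterval_iff] at hf ⊢
  intro ε hε
  obtain ⟨δ, hδ, hfδ⟩ := hf (ε / (C + 1)) (by positivity)
  refine ⟨δ, hδ, fun ⟨n, I⟩ hE hlen => ?_⟩
  -- Cutting each interval down to its initial part up to `r` keeps the family disjoint and does not
  -- lengthen it. Endpoints may come in either order; indices from `n` on get the dummy value `0`.
  have hex : ∀ i, ∃ r, i < n → r ∈ Icc (min (I i).1 (I i).2) (max (I i).1 (I i).2) ∧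
      dist (g (I i).1) (g (I i).2) ≤ C * dist (f (min (I i).1 (I i).2)) (f r) := by
    intro i
    by_cases hi : i < n
    · have hm := hE.1 i (Finset.mem_range.2 hi)
      rcases le_total (I i).1 (I i).2 with hle | hle
      · obtain ⟨r, hr, hd⟩ := h _ hm.1 _ hm.2 hle
        exact ⟨r, fun _ => by rw [min_eq_left hle, max_eq_right hle]; exact ⟨hr, hd⟩⟩
      · obtain ⟨r, hr, hd⟩ := h _ hm.2 _ hm.1 hle
        exact ⟨r, fun _ => by
          rw [min_eq_right hle, max_eq_left hle, dist_comm]; exact ⟨hr, hd⟩⟩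
    · exact ⟨0, fun h => absurd h hi⟩
  choose r hr using hex
  have hsub : ∀ i < n, uIoc (min (I i).1 (I i).2) (r i) ⊆ uIoc (I i).1 (I i).2 := by
    intro i hi
    have := (hr i hi).1
    rw [uIoc_of_le this.1]
    exact Ioc_subset_Ioc_right this.2
  have hmem : (n, fun i => (min (I i).1 (I i).2, r i)) ∈
      AbsolutelyContinuousOnInterval.disjWithin a b := by
    refine ⟨fun i hi => ?_, fun i hi j hj hij => ?_⟩
    · have hm := hE.1 i hi
      have hs : Icc (min (I i).1 (I i).2) (max (I i).1 (I i).2) ⊆ uIcc a b :=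
        uIcc_subset_uIcc hm.1 hm.2
      exact ⟨hs (left_mem_Icc.2 min_le_max), hs (hr i (Finset.mem_range.1 hi)).1⟩
    · exact (hE.2 hi hj hij).mono (hsub i (by simpa using hi)) (hsub j (by simpa using hj))
  have hlen' : ∑ i ∈ Finset.range n, dist (min (I i).1 (I i).2) (r i) < δ := by
    refine lt_of_le_of_lt (Finset.sum_le_sum fun i hi => ?_) hlen
    have := (hr i (Finset.mem_range.1 hi)).1
    change dist _ _ ≤ dist (I i).1 (I i).2
    rw [Real.dist_eq, Real.dist_eq, abs_sub_comm, abs_of_nonneg (sub_nonneg.2 this.1),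
      ← max_sub_min_eq_abs']
    linarith [this.2]
  have hlt := hfδ _ hmem hlen'
  calc ∑ i ∈ Finset.range n, dist (g (I i).1) (g (I i).2)
      ≤ ∑ i ∈ Finset.range n, C * dist (f (min (I i).1 (I i).2)) (f (r i)) :=
        Finset.sum_le_sum fun i hi => (hr i (Finset.mem_range.1 hi)).2
    _ = C * ∑ i ∈ Finset.range n, dist (f (min (I i).1 (I i).2)) (f (r i)) :=
        (Finset.mul_sum _ _ _).symm
    _ ≤ C * (ε / (C + 1)) := mul_le_mul_of_nonneg_left hlt.le hC
    _ < ε := by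
        rw [mul_div_assoc', div_lt_iff₀ (by positivity)]
        nlinarith

/-- The increment of an absolutely continuous function is at most the lower Lebesgue integral of
any almost everywhere upper bound of its derivative. -/
theorem ofReal_sub_le_lintegral {h g : ℝ → ℝ} {τ : ℝ} (hτ : 0 ≤ τ)
    (hac : AbsolutelyContinuousOnInterval h 0 τ)
    (hle : ∀ᵐ t, t ∈ Ioo 0 τ → deriv h t ≤ g t) :
    ENNReal.ofReal (h τ - h 0) ≤ ∫⁻ t in Ioc 0 τ, ENNReal.ofReal (g t) := by
  have hint : IntegrableOn (deriv h) (Ioc 0 τ) :=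
    (intervalIntegrable_iff_integrableOn_Ioc_of_le hτ).1 hac.intervalIntegrable_deriv
  rw [← hac.integral_deriv_eq_sub, intervalIntegral.integral_of_le hτ,
    integral_eq_lintegral_pos_part_sub_lintegral_neg_part hint]
  -- After the negative part is dropped, only monotonicity of the lower integral is needed, so `g`
  -- may be non-measurable or have infinite integral.
  refine (ENNReal.ofReal_le_ofReal (sub_le_self _ ENNReal.toReal_nonneg)).trans
    (ENNReal.ofReal_toReal_le.trans ?_)
  refine lintegral_mono_ae ?_
  rw [ae_restrict_iff' measurableSet_Ioc]
  have hne : ∀ᵐ t : ℝ, t ≠ τ := by simp [ae_iff, measure_singleton]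
  filter_upwards [hle, hne] with t ht htτ htm
  exact ENNReal.ofReal_le_ofReal (ht ⟨htm.1, lt_of_le_of_ne htm.2 htτ⟩)

variable {d : ℕ} {R : Matrix (Fin d) (Fin d) ℝ} {ψ φ η : ℝ → Fin d → ℝ}

/-- The regulator does not move while the reflected path is positive. -/
theorem IsSkorokhodSolution.η_eq_of_pos (hS : IsSkorokhodSolution R ψ φ η) {i : Fin d} {a b : ℝ}
    (ha : 0 ≤ a) (hab : a ≤ b) (hpos : ∀ t ∈ Ioo a b, 0 < φ t i) : η b i = η a i := by
  set F := stieltjesOfIci (fun t => η t i) (hS.η_mono i) (hS.cont_η i) with hF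
  have hmeas : AEMeasurable (fun t => ENNReal.ofReal (φ t i)) (F.measure.restrict (Ici 0)) := by
    refine ENNReal.measurable_ofReal.comp_aemeasurable ?_
    exact ((continuous_apply i).comp_continuousOn hS.cont_φ).aemeasurable measurableSet_Ici
  have hzero := (lintegral_eq_zero_iff' hmeas).1 (hS.compl i)
  have hIoo : F.measure (Ioo a b) = 0 := by
    rw [Filter.EventuallyEq, ae_restrict_iff' measurableSet_Ici, ae_iff] at hzero
    refine measure_mono_null (fun t ht => ?_) hzero
    simp only [mem_ofPred_eq, Pi.zero_apply, ENNReal.ofReal_eq_zero]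
    intro h
    exact absurd (h (ha.trans ht.1.le)) (not_le.2 (hpos t ht))
  have hFc : Continuous F := (hS.cont_η i).comp_continuous
    (continuous_id.max continuous_const) (fun t => le_max_right t 0)
  -- Continuity excludes an atom at `b`, so the open interval carries the whole increment of `η`.
  have hlim : Function.leftLim F b = F b :=
    leftLim_eq_of_tendsto (hFc.continuousAt.tendsto.mono_left nhdsWithin_le_nhds)
  rw [StieltjesFunction.measure_Ioo, hlim, ENNReal.ofReal_eq_zero] at hIoo
  have h1 : F b = η b i := by
    change η (max b 0) i = _; rw [max_eq_left (ha.trans hab)]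
  have h2 : F a = η a i := by
    change η (max a 0) i = _; rw [max_eq_left ha]
  have h3 := hS.η_mono i (mem_Ici.2 ha) (mem_Ici.2 (ha.trans hab)) hab
  simp only at h3
  rw [h1, h2] at hIoo
  linarith

theorem IsSkorokhodSolution.η_le (hS : IsSkorokhodSolution R ψ φ η) {s t : ℝ} (hs : 0 ≤ s)
    (hst : s ≤ t) (i : Fin d) : η s i ≤ η t i :=
  hS.η_mono i (mem_Ici.2 hs) (mem_Ici.2 (hs.trans hst)) hst

/-- With a nonsingular M-matrix, the image of a nonnegative vector is nonpositive in each
coordinate where the vector vanishes. -/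
theorem IsNonsingularMMatrix.mulVec_nonpos (hR : IsNonsingularMMatrix R) {y : Fin d → ℝ}
    (hy : ∀ i, 0 ≤ y i) {i : Fin d} (hi : y i = 0) : (R *ᵥ y) i ≤ 0 := by
  change ∑ j, R i j * y j ≤ 0
  refine Finset.sum_nonpos fun j _ => ?_
  by_cases hij : i = j
  · subst hij; simp [hi]
  · exact mul_nonpos_of_nonpos_of_nonneg (hR.offDiag_nonpos hij) (hy j)

/-- One-sided oscillation inequality for the regulator. -/
theorem IsSkorokhodSolution.mulVec_η_sub_le (hS : IsSkorokhodSolution R ψ φ η)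
    (hR : IsNonsingularMMatrix R) {s t V : ℝ} (hs : 0 ≤ s) (hst : s ≤ t)
    (hV : ∀ r ∈ Icc s t, ‖ψ r - ψ s‖ ≤ V) (i : Fin d) : (R *ᵥ (η t - η s)) i ≤ V := by
  have hV0 : 0 ≤ V := (norm_nonneg _).trans (hV s (left_mem_Icc.2 hst))
  by_cases hex : ∃ r ∈ Icc s t, φ r i = 0
  · have hcont : ContinuousOn (fun r => φ r i) (Icc s t) :=
      ((continuous_apply i).comp_continuousOn hS.cont_φ).mono
        fun r hr => mem_Ici.2 (hs.trans hr.1)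
    have hcomp : IsCompact {r | r ∈ Icc s t ∧ φ r i = 0} :=
      isCompact_Icc.of_isClosed_subset
        (hcont.preimage_isClosed_of_isClosed isClosed_Icc isClosed_singleton) fun r hr => hr.1
    obtain ⟨r₀, hr₀⟩ := hex
    -- Split at the last zero `r` of the coordinate. After it this regulator is frozen and the
    -- off-diagonal signs of `R` give a nonpositive contribution; before it, `φ r i = 0 ≤ φ s i`
    -- bounds the contribution by `ψ s i - ψ r i`.
    obtain ⟨r, ⟨hr, hr0⟩, hmax⟩ := hcomp.exists_isGreatest ⟨r₀, hr₀⟩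
    have hr' : 0 ≤ r := hs.trans hr.1
    have heq : η t i = η r i := hS.η_eq_of_pos hr' hr.2 fun q hq => by
      have hqm : q ∈ Icc s t := ⟨hr.1.trans hq.1.le, hq.2.le⟩
      refine lt_of_le_of_ne (hS.nonneg q (hr'.trans hq.1.le) i) fun h0 => ?_
      exact absurd (hmax ⟨hqm, h0.symm⟩) (not_le.2 hq.1)
    have h1 : (R *ᵥ (η t - η r)) i ≤ 0 :=
      hR.mulVec_nonpos (fun j => sub_nonneg.2 (hS.η_le hr' hr.2 j)) (by simp [heq])
    have e1 := congrFun (hS.eq r hr') i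
    have e2 := congrFun (hS.eq s hs) i
    have h2 := hS.nonneg s hs i
    have h3 : |(ψ r - ψ s) i| ≤ V := (norm_le_pi_norm (ψ r - ψ s) i).trans (hV r hr)
    simp only [Matrix.mulVec_sub, Pi.sub_apply, Pi.add_apply] at h1 e1 e2 h3 ⊢
    have := (abs_le.1 h3).1
    linarith
  · push Not at hex
    have heq : η t i = η s i := hS.η_eq_of_pos hs hst fun q hq =>
      lt_of_le_of_ne (hS.nonneg q (hs.trans hq.1.le) i) (hex q ⟨hq.1.le, hq.2.le⟩).symm
    exact (hR.mulVec_nonpos (fun j => sub_nonneg.2 (hS.η_le hs hst j)) (by simp [heq])).trans hV0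

/-- The regulator of an absolutely continuous path is absolutely continuous. -/
theorem IsSkorokhodSolution.absolutelyContinuous_η (hS : IsSkorokhodSolution R ψ φ η)
    (hR : IsNonsingularMMatrix R) {τ : ℝ} (hτ : 0 ≤ τ)
    (hψ : AbsolutelyContinuousOnInterval ψ 0 τ) : AbsolutelyContinuousOnInterval η 0 τ := by
  obtain ⟨C, hC, hbound⟩ := hR.exists_bound
  refine absolutelyContinuousOnInterval_of_dist_le hC hψ fun s hs t _ hst => ?_
  rw [uIcc_of_le hτ] at hs
  have hcont : ContinuousOn (fun r => ‖ψ r - ψ s‖) (Icc s t) :=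
    ((hS.cont_ψ.mono fun r hr => mem_Ici.2 (hs.1.trans hr.1)).sub continuousOn_const).norm
  -- The largest deviation of `ψ` from `ψ s` is attained at an intermediate `r`; this is why the
  -- comparison criterion allows increments over `[s, r]`.
  obtain ⟨r, hr, hmax⟩ := isCompact_Icc.exists_isMaxOn ⟨s, left_mem_Icc.2 hst⟩ hcont
  refine ⟨r, hr, ?_⟩
  rw [dist_comm, dist_comm (ψ s), dist_eq_norm, dist_eq_norm]
  exact hbound _ _ (fun i => sub_nonneg.2 (hS.η_le hs.1 hst i)) (norm_nonneg _)
    (hS.mulVec_η_sub_le hR hs.1 hst fun q hq => hmax hq)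

/-- The reflection of an absolutely continuous path is absolutely continuous. -/
theorem IsSkorokhodSolution.absolutelyContinuous_φ (hS : IsSkorokhodSolution R ψ φ η)
    (hR : IsNonsingularMMatrix R) {τ : ℝ} (hτ : 0 ≤ τ)
    (hψ : AbsolutelyContinuousOnInterval ψ 0 τ) : AbsolutelyContinuousOnInterval φ 0 τ := by
  have hRη : AbsolutelyContinuousOnInterval (fun t => R *ᵥ η t) 0 τ := by
    refine absolutelyContinuousOnInterval_of_dist_le
      (norm_nonneg R.mulVecLin.toContinuousLinearMap)
      (hS.absolutelyContinuous_η hR hτ hψ) fun s _ t _ hst => ⟨t, right_mem_Icc.2 hst, ?_⟩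
    exact R.mulVecLin.toContinuousLinearMap.dist_le_opNorm (η s) (η t)
  refine absolutelyContinuousOnInterval_of_dist_le zero_le_one (hψ.fun_add hRη)
    fun s hs t ht hst => ⟨t, right_mem_Icc.2 hst, ?_⟩
  rw [uIcc_of_le hτ] at hs ht
  rw [one_mul, hS.eq s hs.1, hS.eq t ht.1]

end

/-! ### Local costs as finite-dimensional minimisation -/

section

/-- The nonnegative vectors supported in `K`: the pushing directions available on `F_K`. -/
def pushCone {d : ℕ} (K : Finset (Fin d)) : Set (Fin d → ℝ) :=
  {p | (∀ i, 0 ≤ p i) ∧ ∀ j, j ∉ K → p j = 0}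

/-- The cost of moving by `u` in time `τ` at constant velocity while pushing at rate `p`. -/
def lineCost {d : ℕ} (θ : Fin d → ℝ) (Sig R : Matrix (Fin d) (Fin d) ℝ) (u : Fin d → ℝ) (τ : ℝ)
    (p : Fin d → ℝ) : ℝ :=
  τ * (1 / 2 * ((τ⁻¹ • u - R *ᵥ p - θ) ⬝ᵥ (Sig⁻¹ *ᵥ (τ⁻¹ • u - R *ᵥ p - θ))))

/-- The least cost of moving by `u` at constant velocity along `F_K`. -/
def faceCost {d : ℕ} (θ : Fin d → ℝ) (Sig R : Matrix (Fin d) (Fin d) ℝ) (K : Finset (Fin d))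
    (u : Fin d → ℝ) : ℝ≥0∞ :=
  ⨅ (τ : ℝ) (_ : 0 < τ) (p : Fin d → ℝ) (_ : p ∈ pushCone K),
    ENNReal.ofReal (lineCost θ Sig R u τ p)

variable {d : ℕ} {θ : Fin d → ℝ} {Sig R : Matrix (Fin d) (Fin d) ℝ} {K : Finset (Fin d)}
  {w v u : Fin d → ℝ}

theorem faceCost_le {τ : ℝ} (hτ : 0 < τ) {p : Fin d → ℝ} (hp : p ∈ pushCone K) :
    faceCost θ Sig R K u ≤ ENNReal.ofReal (lineCost θ Sig R u τ p) :=
  iInf₂_le_of_le τ hτ (iInf₂_le p hp)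

theorem le_faceCost {c : ℝ≥0∞} (h : ∀ τ : ℝ, 0 < τ → ∀ p ∈ pushCone K,
    c ≤ ENNReal.ofReal (lineCost θ Sig R u τ p)) : c ≤ faceCost θ Sig R K u :=
  le_iInf₂ fun τ hτ => le_iInf₂ fun p hp => h τ hτ p hp

/-- Stopping at `τ` lets the reflected path rest at its target, so that it remains in the orthant on
all of `[0,∞)`. The kink at `τ` is a null set for the cost. -/
theorem pathCost_stopped_line (a : Fin d → ℝ) {τ : ℝ} (hτ : 0 < τ) :
    pathCost θ Sig (fun t => w + min t τ • a) τ =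
      ENNReal.ofReal (τ * (1 / 2 * ((a - θ) ⬝ᵥ (Sig⁻¹ *ᵥ (a - θ))))) := by
  have hderiv : ∀ t ∈ Ioo 0 τ, deriv (fun t => w + min t τ • a) t = a := by
    intro t ht
    have heq : (fun t => w + min t τ • a) =ᶠ[𝓝 t] fun t => w + t • a := by
      filter_upwards [Iio_mem_nhds ht.2] with s hs
      rw [min_eq_left (le_of_lt hs)]
    rw [heq.deriv_eq]
    simpa using (((hasDerivAt_id t).smul_const a).const_add w).deriv
  unfold pathCost
  rw [← setLIntegral_congr Ioo_ae_eq_Ioc,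
    setLIntegral_congr_fun measurableSet_Ioo (g := fun _ =>
      ENNReal.ofReal (1 / 2 * ((a - θ) ⬝ᵥ (Sig⁻¹ *ᵥ (a - θ)))))
      (fun t ht => by simp only [hderiv t ht]), setLIntegral_const, Real.volume_Ioo, sub_zero,
    mul_comm, ENNReal.ofReal_mul hτ.le]

theorem isACFrom_stopped_line (a : Fin d → ℝ) {τ : ℝ} (hτ : 0 < τ) :
    IsACFrom w (fun t => w + min t τ • a) := by
  refine ⟨fun t _ => ?_, by simp [hτ.le]⟩
  refine absolutelyContinuousOnInterval_of_dist_le (norm_nonneg a)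
    (contDiff_id.contDiffOn.absolutelyContinuousOnInterval (f := fun t : ℝ => t))
    fun s _ t _ hst => ⟨t, right_mem_Icc.2 hst, ?_⟩
  rw [dist_add_left, dist_eq_norm, ← sub_smul, norm_smul, mul_comm]
  refine mul_le_mul_of_nonneg_left ?_ (norm_nonneg a)
  simpa [Real.dist_eq] using abs_min_sub_min_le_max s τ t τ

theorem stieltjesOfIci_measure_eq_zero {f : ℝ → ℝ} {hm : MonotoneOn f (Ici 0)}
    {hc : ContinuousOn f (Ici 0)} (hf : ∀ t, 0 ≤ t → f t = 0) :
    (stieltjesOfIci f hm hc).measure = 0 := by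
  have : stieltjesOfIci f hm hc = StieltjesFunction.const ℝ 0 := by
    ext t
    exact hf _ (le_max_right t 0)
  rw [this, StieltjesFunction.measure_const]

/-- Constant velocity in the face, with constant pushing, realises the line cost. -/
theorem localCost_le_lineCost (hc : Compatible K w v) {τ : ℝ} (hτ : 0 < τ) {p : Fin d → ℝ}
    (hp : p ∈ pushCone K) :
    localCost θ Sig R K w v ≤ ENNReal.ofReal (lineCost θ Sig R (v - w) τ p) := by
  have hφ_conv : ∀ t : ℝ, ∀ i, (w + (min t τ * τ⁻¹) • (v - w)) i =
      (1 - min t τ * τ⁻¹) * w i + (min t τ * τ⁻¹) * v i := by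
    intro t i
    simp only [Pi.add_apply, Pi.smul_apply, Pi.sub_apply, smul_eq_mul]; ring
  have hfrac : ∀ t, 0 ≤ t → 0 ≤ min t τ * τ⁻¹ ∧ min t τ * τ⁻¹ ≤ 1 := by
    intro t ht
    have h0 : 0 ≤ min t τ := le_min ht hτ.le
    refine ⟨by positivity, ?_⟩
    rw [mul_inv_le_iff₀ hτ, one_mul]
    exact min_le_right _ _
  have hK0 : ∀ t : ℝ, ∀ i ∈ K, (w + (min t τ * τ⁻¹) • (v - w)) i = 0 := by
    intro t i hi
    rw [hφ_conv, (hc.zero i hi).1, (hc.zero i hi).2]; ring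
  have hmono : ∀ i, MonotoneOn (fun t : ℝ => (min t τ • p) i) (Ici 0) := fun i s _ t _ hst =>
    mul_le_mul_of_nonneg_right (min_le_min_right τ hst) (hp.1 i)
  have hS : IsSkorokhodSolution R (fun t => w + min t τ • (τ⁻¹ • (v - w) - R *ᵥ p))
      (fun t => w + (min t τ * τ⁻¹) • (v - w)) (fun t => min t τ • p) := by
    refine ⟨by fun_prop, by simpa [hτ.le] using hc.w_mem, by fun_prop, fun i => ?_, ?_, ?_, ?_,
      hmono, ?_⟩
    · simp only [Pi.smul_apply]; fun_prop
    · intro t _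
      simp only [Matrix.mulVec_smul, smul_sub, smul_smul]
      abel
    · intro t ht i
      rw [hφ_conv]
      have := hfrac t ht
      exact add_nonneg (mul_nonneg (by linarith) (hc.w_mem i)) (mul_nonneg this.1 (hc.v_mem i))
    · intro i; simp [hτ.le]
    · intro i
      by_cases hi : i ∈ K
      · simp only [hK0 _ i hi, ENNReal.ofReal_zero, lintegral_zero]
      · have hz : ∀ t : ℝ, (min t τ • p) i = 0 := fun t => by simp [hp.2 i hi]
        rw [stieltjesOfIci_measure_eq_zero (fun t _ => hz t), Measure.restrict_zero,
          lintegral_zero_measure]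
  refine sInf_le ⟨_, _, _, τ, isACFrom_stopped_line _ hτ, hS, ⟨⟨hτ.le, ?_⟩, ?_⟩, ?_, ?_⟩
  · simp [hτ.ne']
  · rintro t ⟨ht, htv⟩
    by_contra hlt
    push Not at hlt
    simp only [min_eq_left hlt.le] at htv
    have h1 : (1 - t * τ⁻¹) • (v - w) = 0 := by
      rw [sub_smul, one_smul]
      nth_rewrite 1 [← htv]
      abel
    rcases smul_eq_zero.1 h1 with h2 | h2
    · have : t * τ⁻¹ < 1 := by rw [mul_inv_lt_iff₀ hτ]; linarith
      linarith
    · exact hc.ne (sub_eq_zero.1 h2).symm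
  · intro t ht
    refine ⟨hK0 t, fun j hj => ?_⟩
    rw [hφ_conv, min_eq_left ht.2.le]
    have h1 : 0 < t * τ⁻¹ := mul_pos ht.1 (inv_pos.2 hτ)
    have h2 : t * τ⁻¹ < 1 := by rw [mul_inv_lt_iff₀ hτ]; linarith [ht.2]
    rcases hc.pos j hj with h | h
    · have := lt_of_le_of_ne (hc.w_mem j) (Ne.symm h)
      exact add_pos_of_pos_of_nonneg (mul_pos (by linarith) this)
        (mul_nonneg h1.le (hc.v_mem j))
    · have := lt_of_le_of_ne (hc.v_mem j) (Ne.symm h)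
      exact add_pos_of_nonneg_of_pos (mul_nonneg (by linarith) (hc.w_mem j)) (mul_pos h1 this)
  · rw [pathCost_stopped_line _ hτ, lineCost]

/-- Jensen's inequality for the path cost. -/
theorem ofReal_mean_le_pathCost (hSig : Sig.PosDef) {ψ : ℝ → Fin d → ℝ} {τ : ℝ} (hτ : 0 < τ)
    (hψ : AbsolutelyContinuousOnInterval ψ 0 τ) {c : Fin d → ℝ}
    (hc : c = τ⁻¹ • (ψ τ - ψ 0) - θ) :
    ENNReal.ofReal (τ * (1 / 2 * (c ⬝ᵥ (Sig⁻¹ *ᵥ c)))) ≤ pathCost θ Sig ψ τ := by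
  obtain ⟨E, -, hE⟩ := exists_quadraticForm_eq_norm_sq hSig
  -- `ℓ` is the slope of the tangent to half the squared norm at the mean `c`. The tangent lies
  -- below this convex function, and integrating the resulting linear bound gives equality at the
  -- mean.
  let ℓ : (Fin d → ℝ) →L[ℝ] ℝ := (innerSL ℝ (E c)).comp E.toContinuousLinearMap
  have hℓ : ∀ x, ℓ x = inner ℝ (E c) (E x) := fun x => rfl
  have hℓψ : AbsolutelyContinuousOnInterval (fun t => ℓ (ψ t)) 0 τ :=
    absolutelyContinuousOnInterval_of_dist_le (norm_nonneg ℓ) hψ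
      fun s _ t _ hst => ⟨t, right_mem_Icc.2 hst, ℓ.dist_le_opNorm _ _⟩
  have hlin : AbsolutelyContinuousOnInterval
      (fun t : ℝ => t * (ℓ θ + 1 / 2 * ‖E c‖ ^ 2)) 0 τ :=
    (contDiff_id.mul contDiff_const).contDiffOn.absolutelyContinuousOnInterval
  have key := ofReal_sub_le_lintegral hτ.le (hℓψ.fun_sub hlin)
    (g := fun t => 1 / 2 * ((deriv ψ t - θ) ⬝ᵥ (Sig⁻¹ *ᵥ (deriv ψ t - θ)))) (by
      filter_upwards [hψ.boundedVariationOn.ae_differentiableAt_of_mem_uIcc] with t ht htm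
      have hd := (ht (by rw [uIcc_of_le hτ.le]; exact ⟨htm.1.le, htm.2.le⟩)).hasDerivAt
      have h1 : HasDerivAt (fun t => ℓ (ψ t) - t * (ℓ θ + 1 / 2 * ‖E c‖ ^ 2))
          (ℓ (deriv ψ t) - (ℓ θ + 1 / 2 * ‖E c‖ ^ 2)) t :=
        (ℓ.hasFDerivAt.comp_hasDerivAt t hd).sub (by
          simpa using (hasDerivAt_id t).mul_const (ℓ θ + 1 / 2 * ‖E c‖ ^ 2))
      rw [h1.deriv, hE]
      have h2 : ℓ (deriv ψ t) - ℓ θ = inner ℝ (E c) (E (deriv ψ t - θ)) := by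
        rw [← map_sub, hℓ]
      have h3 := norm_sub_sq_real (E c) (E (deriv ψ t - θ))
      have h4 := sq_nonneg ‖E c - E (deriv ψ t - θ)‖
      linarith)
  refine le_trans (le_of_eq ?_) key
  congr 1
  have h5 : ψ τ - ψ 0 = τ • (c + θ) := by
    rw [hc, sub_add_cancel, smul_smul, mul_inv_cancel₀ hτ.ne', one_smul]
  have h6 : ℓ (ψ τ) - ℓ (ψ 0) = τ * (‖E c‖ ^ 2 + ℓ θ) := by
    rw [← map_sub, h5, map_smul, map_add, hℓ c, real_inner_self_eq_norm_sq, smul_eq_mul]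
  rw [hE]
  linarith

/-- Off `K` the regulator never moves, so the averaged push `τ⁻¹ • η τ` lies in the cone and Jensen
applies; the other inequality comes from straight lines. -/
theorem localCost_eq_faceCost (hSig : Sig.PosDef) (hc : Compatible K w v) :
    localCost θ Sig R K w v = faceCost θ Sig R K (v - w) := by
  refine le_antisymm (le_faceCost fun τ hτ p hp => localCost_le_lineCost hc hτ hp) ?_
  refine le_sInf ?_
  rintro _ ⟨ψ, φ, η, τ, hψ, hS, hhit, hface, rfl⟩
  have hη0 : η 0 = 0 := funext hS.η_zero
  have hφ0 : φ 0 = w := by rw [hS.eq 0 le_rfl, hη0, Matrix.mulVec_zero, add_zero, hψ.2]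
  have hτ : 0 < τ := by
    refine lt_of_le_of_ne hhit.1.1 fun h => hc.ne ?_
    rw [← hφ0, h]; exact hhit.1.2
  have hp : τ⁻¹ • η τ ∈ pushCone K := by
    refine ⟨fun i => mul_nonneg (inv_pos.2 hτ).le ?_, fun j hj => ?_⟩
    · rw [← hS.η_zero i]; exact hS.η_le le_rfl hτ.le i
    · have := hS.η_eq_of_pos le_rfl hτ.le fun t ht => (hface t ht).2 j hj
      simp [this, hS.η_zero j]
  refine (faceCost_le hτ hp).trans (ofReal_mean_le_pathCost hSig hτ (hψ.1 τ hτ.le) ?_)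
  have := hS.eq τ hτ.le
  rw [hhit.1.2] at this
  rw [this, hψ.2, Matrix.mulVec_smul, ← smul_sub]
  congr 2
  abel

theorem exists_compatible (hu : u ≠ 0) (hK : ∀ i ∈ K, u i = 0) :
    ∃ w v, Compatible K w v ∧ v - w = u := by
  -- The offset `|u i| + 1` makes both endpoints positive off `K`.
  let w : Fin d → ℝ := fun i => if i ∈ K then 0 else |u i| + 1
  refine ⟨w, w + u, ⟨fun i => ?_, fun i => ?_, ?_, fun i hi => ?_, fun j hj => ?_⟩,
    add_sub_cancel_left _ _⟩
  · dsimp only [w]; split_ifs <;> positivity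
  · dsimp only [w, Pi.add_apply]
    split_ifs with h
    · simp [hK i h]
    · linarith [neg_abs_le (u i)]
  · simpa using hu
  · simp [w, hi, hK i hi]
  · left; dsimp only [w]; rw [if_neg hj]; positivity

/-- All values in the defining infimum coincide, and `exists_compatible` rules out the empty infimum
`⊤`. -/
theorem dirCost_eq_faceCost (hSig : Sig.PosDef) (hu : u ≠ 0) (hK : ∀ i ∈ K, u i = 0) :
    dirCost θ Sig R K u = faceCost θ Sig R K u := by
  refine le_antisymm ?_ (le_sInf ?_)
  · obtain ⟨w, v, hc, rfl⟩ := exists_compatible hu hK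
    exact sInf_le ⟨w, v, hc, rfl, (localCost_eq_faceCost hSig hc).symm⟩
  · rintro _ ⟨w, v, hc, rfl, rfl⟩
    exact (localCost_eq_faceCost hSig hc).ge

end

/-! ### The Cauchy–Schwarz defect and existence of the maximal ratio -/

section

variable {d : ℕ} {θ : Fin d → ℝ} {Sig R : Matrix (Fin d) (Fin d) ℝ} {K : Finset (Fin d)}
  {u : Fin d → ℝ}

/-- The defect in the Cauchy–Schwarz inequality, which is the cost of moving by `u` against the
drift `q` at the optimal speed. -/
def gap (E : (Fin d → ℝ) →ₗ[ℝ] EuclideanSpace ℝ (Fin d)) (u q : Fin d → ℝ) : ℝ :=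
  ‖E u‖ * ‖E q‖ - inner ℝ (E u) (E q)

section Gap

variable {E : (Fin d → ℝ) →ₗ[ℝ] EuclideanSpace ℝ (Fin d)}

theorem gap_nonneg (u q : Fin d → ℝ) : 0 ≤ gap E u q :=
  sub_nonneg.2 (real_inner_le_norm _ _)

theorem gap_smul_right {c : ℝ} (hc : 0 ≤ c) (u q : Fin d → ℝ) :
    gap E u (c • q) = c * gap E u q := by
  simp only [gap, map_smul, norm_smul, inner_smul_right, Real.norm_of_nonneg hc]
  ring

/-- The norm term and the inner product each change by at most `‖E u‖ * ‖E r‖`. This lets `θ` be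
treated as a bounded perturbation of a large push. -/
theorem gap_sub_le_gap_add (u q r : Fin d → ℝ) :
    gap E u q - 2 * (‖E u‖ * ‖E r‖) ≤ gap E u (q + r) := by
  have h1 : ‖E q‖ ≤ ‖E (q + r)‖ + ‖E r‖ := by
    have := norm_sub_le (E (q + r)) (E r)
    rwa [← map_sub, add_sub_cancel_right] at this
  have h2 := real_inner_le_norm (E u) (E r)
  have h3 := mul_le_mul_of_nonneg_left h1 (norm_nonneg (E u))
  simp only [gap, map_add, inner_add_right] at h3 ⊢
  linarith

theorem continuous_gap : Continuous fun x : (Fin d → ℝ) × (Fin d → ℝ) => gap E x.1 x.2 := by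
  have hE : Continuous E := E.continuous_of_finiteDimensional
  unfold gap
  fun_prop

theorem lineCost_eq (hE : ∀ x, x ⬝ᵥ (Sig⁻¹ *ᵥ x) = ‖E x‖ ^ 2) {τ : ℝ} (hτ : 0 < τ)
    (u p : Fin d → ℝ) :
    lineCost θ Sig R u τ p = (τ⁻¹ * ‖E u‖ ^ 2 + τ * ‖E (R *ᵥ p + θ)‖ ^ 2) / 2 -
      inner ℝ (E u) (E (R *ᵥ p + θ)) := by
  have h : τ⁻¹ • u - R *ᵥ p - θ = τ⁻¹ • u - (R *ᵥ p + θ) := by abel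
  rw [lineCost, hE, h, map_sub, norm_sub_sq_real, map_smul, norm_smul, inner_smul_left,
    Real.norm_of_nonneg (inv_pos.2 hτ).le]
  simp only [conj_trivial]
  field_simp
  ring

/-- This is the inequality of arithmetic and geometric means in `τ`; the difference is half of `τ⁻¹
* (‖E u‖ - τ * ‖E q‖) ^ 2` with `q` the drift. -/
theorem gap_le_lineCost (hE : ∀ x, x ⬝ᵥ (Sig⁻¹ *ᵥ x) = ‖E x‖ ^ 2) {τ : ℝ} (hτ : 0 < τ)
    (u p : Fin d → ℝ) : gap E u (R *ᵥ p + θ) ≤ lineCost θ Sig R u τ p := by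
  rw [lineCost_eq hE hτ, gap]
  have h := mul_nonneg (inv_pos.2 hτ).le (sq_nonneg (‖E u‖ - τ * ‖E (R *ᵥ p + θ)‖))
  have h2 : τ⁻¹ * (‖E u‖ - τ * ‖E (R *ᵥ p + θ)‖) ^ 2 =
      τ⁻¹ * ‖E u‖ ^ 2 + τ * ‖E (R *ᵥ p + θ)‖ ^ 2 - 2 * (‖E u‖ * ‖E (R *ᵥ p + θ)‖) := by
    field_simp
    ring
  linarith

theorem exists_lineCost_eq_gap (hE : ∀ x, x ⬝ᵥ (Sig⁻¹ *ᵥ x) = ‖E x‖ ^ 2) {u p : Fin d → ℝ}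
    (hu : E u ≠ 0) (hq : E (R *ᵥ p + θ) ≠ 0) :
    ∃ τ, 0 < τ ∧ lineCost θ Sig R u τ p = gap E u (R *ᵥ p + θ) := by
  have h1 := norm_pos_iff.2 hu
  have h2 := norm_pos_iff.2 hq
  refine ⟨‖E u‖ / ‖E (R *ᵥ p + θ)‖, by positivity, ?_⟩
  rw [lineCost_eq hE (by positivity), gap]
  field_simp
  ring

theorem ne_zero_of_mem_dirSet (hu : u ∈ dirSet K) : u ≠ 0 := by
  rintro rfl
  have := hu.2.1
  simp at this

/-- If the defect vanishes then `q` is a nonnegative multiple of `u`. -/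
theorem exists_smul_of_gap_eq_zero (hinj : Function.Injective E) {q : Fin d → ℝ} (hu : u ≠ 0)
    (h : gap E u q = 0) : ∃ c : ℝ, 0 ≤ c ∧ q = c • u := by
  have h1 : inner ℝ (E u) (E q) = ‖E u‖ * ‖E q‖ := (sub_eq_zero.1 h).symm
  rw [inner_eq_norm_mul_iff_real, ← map_smul, ← map_smul] at h1
  have h2 := hinj h1
  have h3 : 0 < ‖E u‖ := norm_pos_iff.2 ((map_ne_zero_iff E hinj).2 hu)
  refine ⟨‖E u‖⁻¹ * ‖E q‖, by positivity, ?_⟩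
  rw [mul_smul, h2, smul_smul, inv_mul_cancel₀ h3.ne', one_smul]

theorem IsNonsingularMMatrix.drift_neg (hR : IsNonsingularMMatrix R) (hθ : ∀ i, θ i < 0)
    {p : Fin d → ℝ} (hp : p ∈ pushCone K) {j : Fin d} (hj : j ∉ K) : (R *ᵥ p + θ) j < 0 :=
  add_neg_of_nonpos_of_neg (hR.mulVec_nonpos hp.1 (hp.2 j hj)) (hθ j)

theorem gap_drift_pos (hinj : Function.Injective E) (hR : IsNonsingularMMatrix R)
    (hθ : ∀ i, θ i < 0) (hu : u ∈ dirSet K) {p : Fin d → ℝ} (hp : p ∈ pushCone K) :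
    0 < gap E u (R *ᵥ p + θ) := by
  refine lt_of_le_of_ne (gap_nonneg _ _) fun h => ?_
  obtain ⟨c, hc, hq⟩ := exists_smul_of_gap_eq_zero hinj (ne_zero_of_mem_dirSet hu) h.symm
  obtain ⟨j, hj, huj⟩ := hu.2.2
  have h1 := hR.drift_neg hθ hp hj
  rw [hq] at h1
  exact absurd (mul_nonneg hc huj) (not_le.2 h1)

/-- If the defect vanished, `R *ᵥ p` would be a multiple of `u`, hence zero on `K`. Off `K` it is
nonpositive because `p` vanishes there, so the M-matrix property would force `p = 0`. -/
theorem gap_push_pos (hinj : Function.Injective E) (hR : IsNonsingularMMatrix R)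
    (hu : u ∈ dirSet K) {p : Fin d → ℝ} (hp : p ∈ pushCone K) (hp0 : p ≠ 0) :
    0 < gap E u (R *ᵥ p) := by
  refine lt_of_le_of_ne (gap_nonneg _ _) fun h => hp0 (hR.eq_zero hp.1 fun i => ?_)
  obtain ⟨c, -, hq⟩ := exists_smul_of_gap_eq_zero hinj (ne_zero_of_mem_dirSet hu) h.symm
  by_cases hi : i ∈ K
  · rw [hq, Pi.smul_apply, hu.1 i hi, smul_zero]
  · exact hR.mulVec_nonpos hp.1 (hp.2 i hi)

end Gap

theorem isCompact_dirSet (K : Finset (Fin d)) : IsCompact (dirSet K) := by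
  refine Metric.isCompact_of_isClosed_isBounded ?_ ?_
  · have : dirSet K = (⋂ i ∈ K, {u | u i = 0}) ∩ ({u | ∑ i, |u i| = 1} ∩
        ⋃ j ∈ {j | j ∉ K}, {u : Fin d → ℝ | 0 ≤ u j}) := by
      ext u; simp [dirSet]
    rw [this]
    refine IsClosed.inter (isClosed_biInter fun i _ => isClosed_eq (by fun_prop) (by fun_prop))
      (IsClosed.inter (isClosed_eq (by fun_prop) (by fun_prop)) ?_)
    exact (Set.toFinite _).isClosed_biUnion fun j _ => isClosed_le (by fun_prop) (by fun_prop)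
  · refine (Metric.isBounded_closedBall (x := (0 : Fin d → ℝ)) (r := 1)).subset fun u hu => ?_
    rw [mem_closedBall_zero_iff, pi_norm_le_iff_of_nonneg zero_le_one]
    intro i
    rw [← hu.2.1, Real.norm_eq_abs]
    exact Finset.single_le_sum (f := fun i => |u i|) (fun j _ => abs_nonneg _) (Finset.mem_univ i)

theorem dirSet_nonempty (hK : K ⊂ Finset.univ) : (dirSet K).Nonempty := by
  obtain ⟨j, -, hj⟩ := Finset.exists_of_ssubset hK
  refine ⟨Pi.single j 1, fun i hi => ?_, ?_, j, hj, by simp⟩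
  · rw [Pi.single_eq_of_ne]; rintro rfl; exact hj hi
  · rw [Finset.sum_eq_single j (fun i _ h => by simp [h]) (by simp)]; simp

theorem isClosed_pushCone (K : Finset (Fin d)) : IsClosed (pushCone K) := by
  have : pushCone K = (⋂ i, {p : Fin d → ℝ | 0 ≤ p i}) ∩ ⋂ j ∈ {j | j ∉ K}, {p | p j = 0} := by
    ext p; simp [pushCone]
  rw [this]
  exact (isClosed_iInter fun i => isClosed_le (by fun_prop) (by fun_prop)).inter
    (isClosed_biInter fun j _ => isClosed_eq (by fun_prop) (by fun_prop))

theorem smul_mem_pushCone {c : ℝ} (hc : 0 ≤ c) {p : Fin d → ℝ} (hp : p ∈ pushCone K) :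
    c • p ∈ pushCone K :=
  ⟨fun i => mul_nonneg hc (hp.1 i), fun j hj => by simp [hp.2 j hj]⟩

theorem zero_mem_pushCone (K : Finset (Fin d)) : (0 : Fin d → ℝ) ∈ pushCone K :=
  ⟨fun _ => le_rfl, fun _ _ => rfl⟩

variable {E : (Fin d → ℝ) →ₗ[ℝ] EuclideanSpace ℝ (Fin d)}

/-- Pushing is linearly costly, uniformly over the directions. -/
theorem exists_gap_push_ge (hinj : Function.Injective E) (hR : IsNonsingularMMatrix R)
    (K : Finset (Fin d)) :
    ∃ c : ℝ, 0 < c ∧ ∀ u ∈ dirSet K, ∀ p ∈ pushCone K, c * ‖p‖ ≤ gap E u (R *ᵥ p) := by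
  have hcomp : IsCompact (dirSet K ×ˢ (pushCone K ∩ Metric.sphere 0 1)) :=
    (isCompact_dirSet K).prod ((isCompact_sphere _ _).inter_left (isClosed_pushCone K))
  have hcont : Continuous fun x : (Fin d → ℝ) × (Fin d → ℝ) => gap E x.1 (R *ᵥ x.2) :=
    continuous_gap.comp (by fun_prop : Continuous fun x : (Fin d → ℝ) × (Fin d → ℝ) =>
      (x.1, R *ᵥ x.2))
  have hc : ∃ c : ℝ, 0 < c ∧ ∀ u ∈ dirSet K, ∀ p ∈ pushCone K, ‖p‖ = 1 →
      c ≤ gap E u (R *ᵥ p) := by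
    -- The compact set can be empty, for instance when `K = ∅` and the cone is trivial; then any
    -- constant works.
    rcases (dirSet K ×ˢ (pushCone K ∩ Metric.sphere 0 1)).eq_empty_or_nonempty with he | hne
    · refine ⟨1, one_pos, fun u hu p hp hp1 => ?_⟩
      have : (u, p) ∈ dirSet K ×ˢ (pushCone K ∩ Metric.sphere 0 1) := ⟨hu, hp, by simpa using hp1⟩
      rw [he] at this
      exact absurd this (notMem_empty _)
    · obtain ⟨⟨u₀, p₀⟩, ⟨hu₀, hp₀, hp₁⟩, hmin⟩ := hcomp.exists_isMinOn hne hcont.continuousOn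
      refine ⟨gap E u₀ (R *ᵥ p₀), gap_push_pos hinj hR hu₀ hp₀ ?_, fun u hu p hp hp1 => ?_⟩
      · rintro rfl; simp at hp₁
      · have : (u, p) ∈ dirSet K ×ˢ (pushCone K ∩ Metric.sphere 0 1) :=
          ⟨hu, hp, by simpa using hp1⟩
        have h := isMinOn_iff.1 hmin _ this
        exact h
  obtain ⟨c, hc0, hc⟩ := hc
  refine ⟨c, hc0, fun u hu p hp => ?_⟩
  rcases eq_or_ne p 0 with rfl | hp0
  · simp [gap]
  · have hn : 0 < ‖p‖ := norm_pos_iff.2 hp0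
    have h1 := hc u hu (‖p‖⁻¹ • p) (smul_mem_pushCone (inv_pos.2 hn).le hp)
      (by rw [norm_smul, norm_inv, norm_norm, inv_mul_cancel₀ hn.ne'])
    rw [Matrix.mulVec_smul, gap_smul_right (inv_pos.2 hn).le, ← div_eq_inv_mul,
      le_div_iff₀ hn] at h1
    exact h1

/-- For a positive continuous `T`, the ratio of the optimal cost to `T` attains its minimum over the
directions in `F_K`. -/
theorem exists_isMin_gap_div (hinj : Function.Injective E) (hR : IsNonsingularMMatrix R)
    (hK : K ⊂ Finset.univ) {T : (Fin d → ℝ) → ℝ} (hTc : Continuous T)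
    (hTpos : ∀ u, u ≠ 0 → 0 < T u) :
    ∃ u₀ ∈ dirSet K, ∃ p₀ ∈ pushCone K, ∀ u ∈ dirSet K, ∀ p ∈ pushCone K,
      gap E u₀ (R *ᵥ p₀ + θ) / T u₀ ≤ gap E u (R *ᵥ p + θ) / T u := by
  obtain ⟨c, hc, hpush⟩ := exists_gap_push_ge hinj hR K
  have hEc : Continuous E := E.continuous_of_finiteDimensional
  obtain ⟨u₁, hu₁⟩ := dirSet_nonempty hK
  have hTu : ∀ u ∈ dirSet K, 0 < T u := fun u hu => hTpos u (ne_zero_of_mem_dirSet hu)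
  obtain ⟨um, hum, hmax⟩ := (isCompact_dirSet K).exists_isMaxOn ⟨u₁, hu₁⟩ hTc.continuousOn
  obtain ⟨ue, hue, hemax⟩ := (isCompact_dirSet K).exists_isMaxOn ⟨u₁, hu₁⟩
    (f := fun u => ‖E u‖) hEc.norm.continuousOn
  set F₁ := gap E u₁ (R *ᵥ (0 : Fin d → ℝ) + θ) / T u₁ with hF₁
  have hF₁0 : 0 ≤ F₁ := div_nonneg (gap_nonneg _ _) (hTu u₁ hu₁).le
  -- Beyond radius `M` the linear growth in `p` outweighs the perturbation by `θ` and leaves a ratio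
  -- of at least `F₁`, the value at the reference pair `(u₁, 0)`. Minimising over the ball is
  -- therefore enough.
  set M := (F₁ * T um + 2 * (‖E ue‖ * ‖E θ‖)) / c with hM
  have hM0 : 0 ≤ M := by have := hTu um hum; positivity
  have hcomp : IsCompact (dirSet K ×ˢ (pushCone K ∩ Metric.closedBall 0 M)) :=
    (isCompact_dirSet K).prod ((isCompact_closedBall _ _).inter_left (isClosed_pushCone K))
  have hcont : ContinuousOn (fun x : (Fin d → ℝ) × (Fin d → ℝ) =>
      gap E x.1 (R *ᵥ x.2 + θ) / T x.1) (dirSet K ×ˢ (pushCone K ∩ Metric.closedBall 0 M)) := by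
    refine ContinuousOn.div ?_ (hTc.comp continuous_fst).continuousOn
      fun x hx => (hTu x.1 hx.1).ne'
    exact (continuous_gap.comp (by fun_prop : Continuous fun x : (Fin d → ℝ) × (Fin d → ℝ) =>
      (x.1, R *ᵥ x.2 + θ))).continuousOn
  have hmem : (u₁, (0 : Fin d → ℝ)) ∈ dirSet K ×ˢ (pushCone K ∩ Metric.closedBall 0 M) :=
    ⟨hu₁, zero_mem_pushCone K, by simpa using hM0⟩
  obtain ⟨⟨u₀, p₀⟩, ⟨hu₀, hp₀, -⟩, hmin⟩ := hcomp.exists_isMinOn ⟨_, hmem⟩ hcont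
  refine ⟨u₀, hu₀, p₀, hp₀, fun u hu p hp => ?_⟩
  by_cases hpM : ‖p‖ ≤ M
  · have : (u, p) ∈ dirSet K ×ˢ (pushCone K ∩ Metric.closedBall 0 M) :=
      ⟨hu, hp, by simpa using hpM⟩
    have h := isMinOn_iff.1 hmin _ this
    exact h
  · have h1 := isMinOn_iff.1 hmin _ hmem
    refine h1.trans ?_
    rw [le_div_iff₀ (hTu u hu)]
    push Not at hpM
    rw [hM, div_lt_iff₀ hc] at hpM
    have h2 := hpush u hu p hp
    have h3 := gap_sub_le_gap_add (E := E) u (R *ᵥ p) θ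
    have h4 : T u ≤ T um := hmax hu
    have h5 : ‖E u‖ ≤ ‖E ue‖ := hemax hu
    have h6 := mul_le_mul_of_nonneg_right h5 (norm_nonneg (E θ))
    have h7 := mul_le_mul_of_nonneg_left h4 hF₁0
    linarith

theorem dirCost_lt_top (hSig : Sig.PosDef) (hu : u ∈ dirSet K) : dirCost θ Sig R K u < ⊤ := by
  rw [dirCost_eq_faceCost hSig (ne_zero_of_mem_dirSet hu) hu.1]
  exact (faceCost_le one_pos (zero_mem_pushCone K)).trans_lt ENNReal.ofReal_lt_top

/-- Along a single face the cost dominates a multiple of `T`, with equality in some direction. -/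
theorem exists_isMin_dirCost_div (hSig : Sig.PosDef) (hR : IsNonsingularMMatrix R)
    (hθ : ∀ i, θ i < 0) (hK : K ⊂ Finset.univ) {T : (Fin d → ℝ) → ℝ} (hTc : Continuous T)
    (hTpos : ∀ u, u ≠ 0 → 0 < T u) :
    ∃ m : ℝ, 0 < m ∧ (∀ u ∈ dirSet K, ENNReal.ofReal (m * T u) ≤ dirCost θ Sig R K u) ∧
      ∃ u ∈ dirSet K, dirCost θ Sig R K u = ENNReal.ofReal (m * T u) := by
  obtain ⟨E, hinj, hE⟩ := exists_quadraticForm_eq_norm_sq hSig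
  obtain ⟨u₀, hu₀, p₀, hp₀, hmin⟩ := exists_isMin_gap_div (θ := θ) hinj hR hK hTc hTpos
  have hT₀ := hTpos u₀ (ne_zero_of_mem_dirSet hu₀)
  have hle : ∀ u ∈ dirSet K, ENNReal.ofReal (gap E u₀ (R *ᵥ p₀ + θ) / T u₀ * T u) ≤
      dirCost θ Sig R K u := by
    intro u hu
    rw [dirCost_eq_faceCost hSig (ne_zero_of_mem_dirSet hu) hu.1]
    refine le_faceCost fun τ hτ p hp => ENNReal.ofReal_le_ofReal ?_
    refine le_trans ?_ (gap_le_lineCost hE hτ u p)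
    exact (le_div_iff₀ (hTpos u (ne_zero_of_mem_dirSet hu))).1 (hmin u hu p hp)
  refine ⟨_, div_pos (gap_drift_pos hinj hR hθ hu₀ hp₀) hT₀, hle, u₀, hu₀,
    le_antisymm ?_ (hle u₀ hu₀)⟩
  -- A nonzero drift is needed for the optimal duration `‖E u‖ / ‖E q‖` to be finite.
  have hq : R *ᵥ p₀ + θ ≠ 0 := by
    obtain ⟨j, hj, -⟩ := hu₀.2.2
    intro h
    have := hR.drift_neg hθ hp₀ hj
    rw [h] at this
    exact lt_irrefl _ this
  obtain ⟨τ, hτ, heq⟩ := exists_lineCost_eq_gap hE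
    ((map_ne_zero_iff E hinj).2 (ne_zero_of_mem_dirSet hu₀)) ((map_ne_zero_iff E hinj).2 hq)
  rw [dirCost_eq_faceCost hSig (ne_zero_of_mem_dirSet hu₀) hu₀.1, div_mul_cancel₀ _ hT₀.ne', ← heq]
  exact faceCost_le hτ hp₀

/-- The face-wise minimum exists for any positive continuous gauge; the sup norm serves here. -/
theorem dirCost_pos (hSig : Sig.PosDef) (hR : IsNonsingularMMatrix R) (hθ : ∀ i, θ i < 0)
    (hK : K ⊂ Finset.univ) (hu : u ∈ dirSet K) : 0 < dirCost θ Sig R K u := by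
  obtain ⟨m, hm, hle, -⟩ := exists_isMin_dirCost_div hSig hR hθ hK continuous_norm
    fun u hu => norm_pos_iff.2 hu
  have := norm_pos_iff.2 (ne_zero_of_mem_dirSet hu)
  exact (ENNReal.ofReal_pos.2 (by positivity)).trans_le (hle u hu)

theorem exists_isGreatest_ratioSet (hd : 1 ≤ d) (hSig : Sig.PosDef) (hR : IsNonsingularMMatrix R)
    (hθ : ∀ i, θ i < 0) {T : (Fin d → ℝ) → ℝ} (hTc : Continuous T)
    (hTpos : ∀ u, u ≠ 0 → 0 < T u) : ∃ r, 0 < r ∧ IsGreatest (ratioSet θ Sig R T) r := by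
  have hface : ∀ K : Finset (Fin d), K ⊂ Finset.univ → ∃ ρ : ℝ, 0 < ρ ∧
      (∀ u ∈ dirSet K, T u / (dirCost θ Sig R K u).toReal ≤ ρ) ∧
      ∃ u ∈ dirSet K, ρ = T u / (dirCost θ Sig R K u).toReal := by
    intro K hK
    obtain ⟨m, hm, hle, u₀, hu₀, heq⟩ := exists_isMin_dirCost_div hSig hR hθ hK hTc hTpos
    -- The least value `m` of cost over `T` on the face is the reciprocal of the greatest ratio.
    refine ⟨m⁻¹, inv_pos.2 hm, fun u hu => ?_, u₀, hu₀, ?_⟩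
    · have hT := hTpos u (ne_zero_of_mem_dirSet hu)
      have h1 := (ENNReal.ofReal_le_iff_le_toReal (dirCost_lt_top hSig hu).ne).1 (hle u hu)
      have h2 : 0 < (dirCost θ Sig R K u).toReal := lt_of_lt_of_le (by positivity) h1
      rw [div_le_iff₀ h2, ← div_eq_inv_mul, le_div_iff₀ hm]
      linarith
    · have hT := hTpos u₀ (ne_zero_of_mem_dirSet hu₀)
      rw [heq, ENNReal.toReal_ofReal (by positivity)]
      field_simp
  choose! ρ hρ0 hρle hρeq using hface
  have hne : ((Finset.univ : Finset (Finset (Fin d))).filter (· ⊂ Finset.univ)).Nonempty := by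
    have : Nonempty (Fin d) := ⟨⟨0, hd⟩⟩
    exact ⟨∅, by simp [Finset.ssubset_iff_subset_ne, Finset.univ_nonempty.ne_empty.symm]⟩
  obtain ⟨K₀, hK₀, hmax⟩ := Finset.exists_max_image _ ρ hne
  rw [Finset.mem_filter] at hK₀
  obtain ⟨u₀, hu₀, heq⟩ := hρeq K₀ hK₀.2
  refine ⟨ρ K₀, hρ0 K₀ hK₀.2, ⟨K₀, u₀, hK₀.2, hu₀, heq⟩, ?_⟩
  rintro _ ⟨K, u, hK, hu, rfl⟩
  exact (hρle K hK u hu).trans (hmax K (by simp [hK]))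

end

/-! ### Growth of `T` along reflected paths and the subsolution property -/

section

variable {d : ℕ} {θ : Fin d → ℝ} {Sig R : Matrix (Fin d) (Fin d) ℝ} {K : Finset (Fin d)}

theorem continuous_seminorm (T : Seminorm ℝ (Fin d → ℝ)) : Continuous T :=
  continuousOn_univ.1 (T.convexOn.continuousOn isOpen_univ)

/-- The rate at which cost accrues dominates the rate at which `T` can grow inside a face. -/
theorem seminorm_le_mul_rate (hSig : Sig.PosDef) (hR : IsNonsingularMMatrix R)
    (hθ : ∀ i, θ i < 0) (T : Seminorm ℝ (Fin d → ℝ)) {r : ℝ} (hr0 : 0 ≤ r)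
    (hr : r ∈ upperBounds (ratioSet θ Sig R T)) (hK : K ⊂ Finset.univ) {u p : Fin d → ℝ}
    (huK : ∀ i ∈ K, u i = 0) (huj : ∃ j, j ∉ K ∧ 0 ≤ u j) (hp : p ∈ pushCone K) :
    T u ≤ r * (1 / 2 * ((u - R *ᵥ p - θ) ⬝ᵥ (Sig⁻¹ *ᵥ (u - R *ᵥ p - θ)))) := by
  obtain ⟨E, -, hE⟩ := exists_quadraticForm_eq_norm_sq hSig
  rcases eq_or_ne u 0 with rfl | hu
  · rw [map_zero, hE]; positivity
  set s := ∑ i, |u i| with hs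
  have hs0 : 0 < s := by
    obtain ⟨i, hi⟩ := Function.ne_iff.1 hu
    exact Finset.sum_pos' (fun i _ => abs_nonneg _) ⟨i, Finset.mem_univ i, abs_pos.2 hi⟩
  have hmem : s⁻¹ • u ∈ dirSet K := by
    refine ⟨fun i hi => by simp [huK i hi], ?_, ?_⟩
    · simp only [Pi.smul_apply, smul_eq_mul, abs_mul, ← Finset.mul_sum, ← hs]
      rw [abs_of_pos (inv_pos.2 hs0), inv_mul_cancel₀ hs0.ne']
    · obtain ⟨j, hj, h⟩ := huj
      exact ⟨j, hj, mul_nonneg (inv_pos.2 hs0).le h⟩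
  -- Covering the normalised displacement in time `s⁻¹` restores the velocity `u`, so its cost is
  -- `s⁻¹` times the running rate.
  have hcost : dirCost θ Sig R K (s⁻¹ • u) ≤ ENNReal.ofReal (lineCost θ Sig R (s⁻¹ • u) s⁻¹ p) := by
    rw [dirCost_eq_faceCost hSig (ne_zero_of_mem_dirSet hmem) hmem.1]
    exact faceCost_le (inv_pos.2 hs0) hp
  have hpos : 0 < (dirCost θ Sig R K (s⁻¹ • u)).toReal :=
    ENNReal.toReal_pos (dirCost_pos hSig hR hθ hK hmem).ne' (dirCost_lt_top hSig hmem).ne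
  have h1 := hr ⟨K, s⁻¹ • u, hK, hmem, rfl⟩
  rw [div_le_iff₀ hpos] at h1
  have h2 : (dirCost θ Sig R K (s⁻¹ • u)).toReal ≤
      s⁻¹ * (1 / 2 * ((u - R *ᵥ p - θ) ⬝ᵥ (Sig⁻¹ *ᵥ (u - R *ᵥ p - θ)))) := by
    refine ENNReal.toReal_le_of_le_ofReal ?_ (hcost.trans_eq ?_)
    · rw [hE]; positivity
    · rw [lineCost, inv_inv, smul_smul, mul_inv_cancel₀ hs0.ne', one_smul]
  have h3 := h1.trans (mul_le_mul_of_nonneg_left h2 hr0)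
  rw [map_smul_eq_mul, Real.norm_of_nonneg (inv_pos.2 hs0).le, mul_left_comm] at h3
  exact le_of_mul_le_mul_left h3 (inv_pos.2 hs0)

/-- The derivative of a seminorm along a path is bounded by any one-sided bound along its
tangent. -/
theorem hasDerivAt_seminorm_le (T : Seminorm ℝ (Fin d → ℝ)) {φ : ℝ → Fin d → ℝ} {u : Fin d → ℝ}
    {t D B : ℝ} (hφ : HasDerivAt φ u t) (hT : HasDerivAt (fun s => T (φ s)) D t)
    (hB : ∀ᶠ h in 𝓝[>] (0 : ℝ), T (φ t + h • u) ≤ T (φ t) + h * B) : D ≤ B := by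
  have h1 := hT.tendsto_slope_zero_right
  have h2 : Tendsto (fun h : ℝ => B + T (h⁻¹ • (φ (t + h) - φ t) - u)) (𝓝[>] 0) (𝓝 B) := by
    have h3 := hφ.tendsto_slope_zero_right.sub_const u
    have h4 := ((continuous_seminorm T).tendsto _).comp h3
    rw [sub_self, map_zero] at h4
    simpa using h4.const_add B
  refine le_of_tendsto_of_tendsto h1 h2 ?_
  filter_upwards [hB, self_mem_nhdsWithin] with h hh hpos
  have hpos : 0 < h := hpos
  have e : φ (t + h) = (φ t + h • u) + h • (h⁻¹ • (φ (t + h) - φ t) - u) := by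
    rw [smul_sub, smul_smul, mul_inv_cancel₀ hpos.ne', one_smul]; abel
  have h5 := map_add_le_add T (φ t + h • u) (h • (h⁻¹ • (φ (t + h) - φ t) - u))
  rw [← e, map_smul_eq_mul, Real.norm_of_nonneg hpos.le] at h5
  rw [smul_eq_mul, inv_mul_le_iff₀ hpos]
  linarith

variable {ψ φ η : ℝ → Fin d → ℝ}

/-- A zero coordinate at a positive time is an interior minimum of a nonnegative function. -/
theorem IsSkorokhodSolution.deriv_φ_eq_zero (hS : IsSkorokhodSolution R ψ φ η) {t : ℝ}
    (ht : 0 < t) {u : Fin d → ℝ} (hu : HasDerivAt φ u t) {i : Fin d} (hi : φ t i = 0) :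
    u i = 0 := by
  refine IsLocalMin.hasDerivAt_eq_zero (f := fun s => φ s i) (a := t) ?_ (hasDerivAt_pi.1 hu i)
  filter_upwards [Ioi_mem_nhds ht] with s hs
  rw [hi]
  exact hS.nonneg s (le_of_lt hs) i

theorem IsSkorokhodSolution.deriv_η_nonneg (hS : IsSkorokhodSolution R ψ φ η) {t : ℝ}
    (ht : 0 < t) {p : Fin d → ℝ} (hp : HasDerivAt η p t) (i : Fin d) : 0 ≤ p i := by
  refine ge_of_tendsto (hasDerivAt_pi.1 hp i).tendsto_slope_zero_right ?_
  filter_upwards [self_mem_nhdsWithin] with h hh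
  have hh : 0 < h := hh
  exact mul_nonneg (inv_pos.2 hh).le (sub_nonneg.2 (hS.η_le ht.le (by linarith) i))

theorem IsSkorokhodSolution.deriv_η_eq_zero (hS : IsSkorokhodSolution R ψ φ η) {t : ℝ}
    (ht : 0 < t) {p : Fin d → ℝ} (hp : HasDerivAt η p t) {i : Fin d} (hi : 0 < φ t i) :
    p i = 0 := by
  have hcont : ContinuousAt (fun s => φ s i) t :=
    ((continuous_apply i).comp_continuousOn hS.cont_φ).continuousAt (Ici_mem_nhds ht)
  obtain ⟨ε, hε, hball⟩ := Metric.eventually_nhds_iff.1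
    ((hcont.eventually (lt_mem_nhds hi)).and (Ioi_mem_nhds ht))
  have hconst : (fun s => η s i) =ᶠ[𝓝 t] fun _ => η t i := by
    filter_upwards [Metric.ball_mem_nhds t hε] with s hs
    have hpos : ∀ q ∈ uIcc s t, 0 < φ q i := by
      intro q hq
      refine (hball ?_).1
      rw [Metric.mem_ball] at hs
      exact lt_of_le_of_lt (by
        rw [dist_comm, dist_comm s, Real.dist_eq, Real.dist_eq]; exact abs_sub_right_of_mem_uIcc hq) hs
    rcases le_total s t with hst | hst
    · exact (hS.η_eq_of_pos (le_of_lt (hball hs).2) hst fun q hq => hpos q (by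
        rw [uIcc_of_le hst]; exact ⟨hq.1.le, hq.2.le⟩)).symm
    · exact hS.η_eq_of_pos ht.le hst fun q hq => hpos q (by
        rw [uIcc_of_ge hst]; exact ⟨hq.1.le, hq.2.le⟩)
  exact (hasDerivAt_pi.1 hp i).unique ((hasDerivAt_const t (η t i)).congr_of_eventuallyEq hconst)

/-- Along a reflected path, `T` grows at most `r` times as fast as the cost. -/
theorem IsSkorokhodSolution.deriv_seminorm_le (hS : IsSkorokhodSolution R ψ φ η)
    (hSig : Sig.PosDef) (hR : IsNonsingularMMatrix R) (hθ : ∀ i, θ i < 0)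
    (T : Seminorm ℝ (Fin d → ℝ))
    (hT_mono : ∀ v ∈ orthant d, ∀ w ∈ orthant d, v ≤ w → T v ≤ T w) {r : ℝ} (hr0 : 0 ≤ r)
    (hr : r ∈ upperBounds (ratioSet θ Sig R T)) {t D : ℝ} (ht : 0 < t) {u p : Fin d → ℝ}
    (hu : HasDerivAt φ u t) (hp : HasDerivAt η p t) (hD : HasDerivAt (fun s => T (φ s)) D t) :
    D ≤ r * (1 / 2 * ((u - R *ᵥ p - θ) ⬝ᵥ (Sig⁻¹ *ᵥ (u - R *ᵥ p - θ)))) := by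
  obtain ⟨E, -, hE⟩ := exists_quadraticForm_eq_norm_sq hSig
  have hrate0 : 0 ≤ r * (1 / 2 * ((u - R *ᵥ p - θ) ⬝ᵥ (Sig⁻¹ *ᵥ (u - R *ᵥ p - θ)))) := by
    rw [hE]; positivity
  have hDT : D ≤ T u := by
    refine hasDerivAt_seminorm_le T hu hD ?_
    filter_upwards [self_mem_nhdsWithin] with h hh
    have hh : 0 < h := hh
    refine (map_add_le_add T _ _).trans_eq ?_
    rw [map_smul_eq_mul, Real.norm_of_nonneg hh.le]
  let K : Finset (Fin d) := Finset.univ.filter fun i => φ t i = 0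
  have hmemK : ∀ i, i ∈ K ↔ φ t i = 0 := fun i => by simp [K]
  have hposK : ∀ j, j ∉ K → 0 < φ t j := fun j hj =>
    lt_of_le_of_ne (hS.nonneg t ht.le j) fun h => hj ((hmemK j).2 h.symm)
  have huK : ∀ i ∈ K, u i = 0 := fun i hi => hS.deriv_φ_eq_zero ht hu ((hmemK i).1 hi)
  have hpK : p ∈ pushCone K :=
    ⟨hS.deriv_η_nonneg ht hp, fun j hj => hS.deriv_η_eq_zero ht hp (hposK j hj)⟩
  by_cases hex : ∃ j, j ∉ K ∧ 0 ≤ u j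
  · have hK : K ⊂ Finset.univ := by
      obtain ⟨j, hj, -⟩ := hex
      exact Finset.ssubset_univ_iff.2 fun h => hj (h ▸ Finset.mem_univ j)
    exact hDT.trans (seminorm_le_mul_rate hSig hR hθ T hr0 hr hK huK hex hpK)
  · push Not at hex
    have hu0 : ∀ i, u i ≤ 0 := fun i => by
      by_cases hi : i ∈ K
      · exact (huK i hi).le
      · exact (hex i hi).le
    -- Every coordinate of the velocity is now nonpositive (this includes `K` being everything). A
    -- short tangent step stays in the orthant and moves down, so `T` cannot increase, and the cost
    -- rate is nonnegative.
    refine (hasDerivAt_seminorm_le T hu hD (B := 0) ?_).trans hrate0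
    have hmem : ∀ᶠ h in 𝓝[>] (0 : ℝ), ∀ i, 0 ≤ (φ t + h • u) i := by
      refine eventually_all.2 fun i => ?_
      by_cases hi : i ∈ K
      · simp [(hmemK i).1 hi, huK i hi]
      · have hc : Continuous fun h : ℝ => (φ t + h • u) i := by
          simp only [Pi.add_apply, Pi.smul_apply]; fun_prop
        have h0 : (0 : ℝ) < (φ t + (0 : ℝ) • u) i := by simpa using hposK i hi
        filter_upwards [nhdsWithin_le_nhds (hc.continuousAt.eventually (lt_mem_nhds h0))] with h hh
        exact le_of_lt hh
    filter_upwards [hmem, self_mem_nhdsWithin] with h hh hpos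
    have hpos : 0 < h := hpos
    rw [mul_zero, add_zero]
    refine hT_mono _ hh _ (hS.nonneg t ht.le) fun i => ?_
    have := mul_nonpos_of_nonneg_of_nonpos hpos.le (hu0 i)
    simp only [Pi.add_apply, Pi.smul_apply, smul_eq_mul]
    linarith

/-- The increment of `T` between the endpoints bounds the global cost from below. -/
theorem ofReal_le_globalCost (hSig : Sig.PosDef) (hR : IsNonsingularMMatrix R)
    (hθ : ∀ i, θ i < 0) (T : Seminorm ℝ (Fin d → ℝ))
    (hT_mono : ∀ v ∈ orthant d, ∀ w ∈ orthant d, v ≤ w → T v ≤ T w) {r : ℝ} (hr0 : 0 < r)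
    (hr : r ∈ upperBounds (ratioSet θ Sig R T)) (w v : Fin d → ℝ) :
    ENNReal.ofReal (r⁻¹ * T v - r⁻¹ * T w) ≤ globalCost θ Sig R w v := by
  refine le_sInf ?_
  rintro _ ⟨ψ, φ, η, τ, hψ, hS, hhit, rfl⟩
  have hτ : 0 ≤ τ := hhit.1.1
  have hη0 : η 0 = 0 := funext hS.η_zero
  have hφ0 : φ 0 = w := by rw [hS.eq 0 le_rfl, hη0, Matrix.mulVec_zero, add_zero, hψ.2]
  have hψτ := hψ.1 τ hτ
  have hητ := hS.absolutelyContinuous_η hR hτ hψτ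
  have hφτ := hS.absolutelyContinuous_φ hR hτ hψτ
  obtain ⟨C, hC, hbound⟩ := Seminorm.bound_of_continuous_normedSpace T (continuous_seminorm T)
  have hTφ : AbsolutelyContinuousOnInterval (fun t => T (φ t)) 0 τ :=
    absolutelyContinuousOnInterval_of_dist_le hC.le hφτ fun s _ t _ hst =>
      ⟨t, right_mem_Icc.2 hst, by
        rw [Real.dist_eq, dist_eq_norm]
        exact (abs_sub_map_le_sub T _ _).trans (hbound _)⟩
  have key := ofReal_sub_le_lintegral hτ (hTφ.const_mul r⁻¹)
    (g := fun t => 1 / 2 * ((deriv ψ t - θ) ⬝ᵥ (Sig⁻¹ *ᵥ (deriv ψ t - θ)))) (by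
      filter_upwards [hητ.boundedVariationOn.ae_differentiableAt_of_mem_uIcc,
        hφτ.boundedVariationOn.ae_differentiableAt_of_mem_uIcc, hTφ.ae_differentiableAt]
        with t h1 h2 h3 htm
      have hmem : t ∈ uIcc 0 τ := by rw [uIcc_of_le hτ]; exact ⟨htm.1.le, htm.2.le⟩
      have hp := (h1 hmem).hasDerivAt
      have hu := (h2 hmem).hasDerivAt
      have hD := (h3 hmem).hasDerivAt
      have hψ' : deriv ψ t = deriv φ t - R *ᵥ deriv η t := by
        have heq : ψ =ᶠ[𝓝 t] fun s => φ s - R *ᵥ η s := by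
          filter_upwards [Ioi_mem_nhds htm.1] with s hs
          rw [hS.eq s (le_of_lt hs), add_sub_cancel_right]
        rw [heq.deriv_eq]
        exact (hu.sub (R.mulVecLin.toContinuousLinearMap.hasFDerivAt.comp_hasDerivAt t hp)).deriv
      rw [(hD.const_mul r⁻¹).deriv, hψ', inv_mul_le_iff₀ hr0]
      exact hS.deriv_seminorm_le hSig hR hθ T hT_mono hr0.le hr htm.1 hu hp hD)
  rw [hφ0, hhit.1.2] at key
  exact key

theorem isSubsolution_Tbar (hSig : Sig.PosDef) (hR : IsNonsingularMMatrix R)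
    (hθ : ∀ i, θ i < 0) (T : Seminorm ℝ (Fin d → ℝ))
    (hT_mono : ∀ v ∈ orthant d, ∀ w ∈ orthant d, v ≤ w → T v ≤ T w)
    (hr0 : 0 < scale θ Sig R T) (hr : scale θ Sig R T ∈ upperBounds (ratioSet θ Sig R T)) :
    IsSubsolution θ Sig R (Tbar θ Sig R T) := by
  refine ⟨?_, fun x hx => ?_, fun w _ v _ => ?_⟩
  · have := continuous_seminorm T
    unfold Tbar
    fun_prop
  · have h : sInf ((fun x => T x / scale θ Sig R T) '' targetSet d) ≤ T x / scale θ Sig R T :=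
      csInf_le ⟨0, by rintro _ ⟨y, -, rfl⟩; exact div_nonneg (apply_nonneg T y) hr0.le⟩
        ⟨x, hx, rfl⟩
    unfold Tbar
    linarith
  · have h := ofReal_le_globalCost hSig hR hθ T hT_mono hr0 hr w v
    have h1 : Tbar θ Sig R T w - Tbar θ Sig R T v =
        (scale θ Sig R T)⁻¹ * T v - (scale θ Sig R T)⁻¹ * T w := by
      unfold Tbar; ring
    rw [h1]
    -- The cast of `ENNReal.ofReal` to `EReal` is a maximum with `0`, so a negative increment is
    -- harmless.
    refine le_trans ?_ (EReal.coe_ennreal_le_coe_ennreal_iff.2 h)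
    rw [EReal.coe_ennreal_ofReal]
    exact EReal.coe_le_coe_iff.2 (le_max_left _ _)

end

end SRBM

end

theorem theorem4p3 (d : ℕ) (hd : 1 ≤ d)
    (θ : Fin d → ℝ) (Sig R : Matrix (Fin d) (Fin d) ℝ)
    (hSig : Sig.PosDef)
    (hR : SRBM.IsNonsingularMMatrix R) (hθ : ∀ i, θ i < 0)
    (T : Seminorm ℝ (Fin d → ℝ)) (hT_norm : ∀ x, T x = 0 → x = 0)
    (hT_mono : ∀ v ∈ SRBM.orthant d, ∀ w ∈ SRBM.orthant d, v ≤ w → T v ≤ T w) :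
    (∀ (K : Finset (Fin d)) (w v : Fin d → ℝ), SRBM.Compatible K w v →
        SRBM.localCost θ Sig R K w v = SRBM.dirCost θ Sig R K (v - w)) ∧
    (∀ K : Finset (Fin d), K ⊂ Finset.univ → ∀ u ∈ SRBM.dirSet K,
        0 < SRBM.dirCost θ Sig R K u ∧ SRBM.dirCost θ Sig R K u < ⊤) ∧
    IsGreatest (SRBM.ratioSet θ Sig R T) (SRBM.scale θ Sig R T) ∧
    0 < SRBM.scale θ Sig R T ∧
    SRBM.IsSubsolution θ Sig R (SRBM.Tbar θ Sig R T) := by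
  have hTpos : ∀ u, u ≠ 0 → 0 < T u := fun u hu =>
    lt_of_le_of_ne (apply_nonneg T u) fun h => hu (hT_norm u h.symm)
  obtain ⟨r, hr0, hr⟩ := SRBM.exists_isGreatest_ratioSet hd hSig hR hθ
    (SRBM.continuous_seminorm T) hTpos
  have hscale : SRBM.scale θ Sig R T = r := hr.csSup_eq
  refine ⟨fun K w v hc => ?_, fun K hK u hu =>
    ⟨SRBM.dirCost_pos hSig hR hθ hK hu, SRBM.dirCost_lt_top hSig hu⟩, hscale ▸ hr, hscale ▸ hr0,
    SRBM.isSubsolution_Tbar hSig hR hθ T hT_mono (hscale ▸ hr0) (hscale ▸ hr.2)⟩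
  rw [SRBM.localCost_eq_faceCost hSig hc, SRBM.dirCost_eq_faceCost hSig (sub_ne_zero.2 hc.ne.symm)
    fun i hi => by simp [hc.zero i hi]]
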